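/- For $n\ge 2$ let $\mathcal H_n$ be the honeycomb spin-network of side $n$: the planar trivalent graph formed by the $n\times n$ rhombus of hexagonal cells (rows of $1,2,\dots,n,\dots,2,1$ cells from top to bottom), binary vertices on the perimeter being erased, with arbitrary (symbolic) spin colors on its edges. The crown of $\mathcal H_n$ consists of the $2n-1$ cells of its upper perimeter (the cells not contained in the copy of $\mathcal H_{n-1}$ at the bottom of $\mathcal H_n$). Three moves are used. - *Recoupling* at an edge $j$ joining a vertex with further edges $a,b$ to a vertex with further edges $c,d$: $j$ is replaced by an edge $i$ joining vertices with further edges $b,c$ and $a,d$, with the coefficient $\begin{Bmatrix} a&b&i\\ c&d&j\end{Bmatrix}$ and a new summation over the compatible colors $i$. - *Schur's lemma*: a bubble (a face with two sides $x,y$) entered by edges $p,q$ is replaced by a single edge, with the factor $\delta_{p,q}\,\theta(p,x,y)/\Delta_p$; the Kronecker delta eliminates a summation index. - *Bubble move*: a triangular face with sides $a,d,e$, entered by edges $b$ (between $a$ and $e$), $c$ (between $e$ and $d$) and $f$ (between $a$ and $d$), is replaced by a vertex, with the factor $\begin{Bmatrix} a&b&f\\ c&d&e\end{Bmatrix}\Delta_f^{-1}\theta(a,d,f)$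 and no summation. The algorithm evaluates $\mathcal H_n$ as follows. While $n\ge 3$: apply the bubble move to the top cell; apply recoupling to the edge between the two crown cells adjacent to the top cell, to every edge between two consecutive crown cells further down on either side, and to the bottom edges of the two most lateral cells; remove all bubbles by Schur's lemma; apply the bubble move to each of the remaining crown cells on either side (those other than the top cell, its two neighbors in the crown and the two most lateral cells). The result is a combination of copies of $\mathcal H_{n-1}$, which keep the colors of the bulk; replace $n$ by $n-1$. When $n=2$, the bubble move at the top yields a tetrahedron, whose value is known. Then for every $n\ge2$ the algorithm can be carried out on $\mathcal H_n$, and the number $a_n$ of summation indices in the evaluation formula it returns is the same for every run of the algorithm. These numbers satisfy $$a_n=a_{n-1}+2n-5\qquad (n\ge 3),$$ and consequently the number of summations grows quadratically in $n$: $a_n=\Theta(n^2)$ as $n\to\infty$. -/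

import Mathlib

namespace HoneycombNet

/-! ### Trivalent planar spin-networks -/

/-- A trivalent vertex, given by the colours of its three edges in counterclockwise order. -/
def vert {α : Type} (a b c : α) : Cycle α := (([a, b, c] : List α) : Cycle α)

/-- A closed trivalent planar spin-network, given by the multiset of its vertices.  Its edges are
identified with the (pairwise distinct) variables which stand for their spin colours: two vertices
are joined by an edge when they share a variable. -/
abbrev Net (α : Type) : Type := Multiset (Cycle α)

/-- Change of the names of the colours in a network. -/
def Net.map {α β : Type} (f : α → β) (N : Net α) : Net β :=
  Multiset.map (Cycle.map f) N

/-! ### The honeycomb `H_n` -/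

/-- Hexagons of the infinite honeycomb lattice, in axial coordinates.  The neighbours of the hexagon
`c` are `c ± (1, 0)`, `c ± (0, 1)` and `c ± (1, -1)`; the vectors `(1, 0)` and `(0, 1)` point
to the upper right and to the upper left. -/
abbrev Cell : Type := ℤ × ℤ

/-- A face of `H_n`: a hexagon, or the outer region `none`. -/
abbrev Face : Type := Option Cell

/-- An edge of `H_n`, given by the two faces that it separates. -/
abbrev Edge : Type := Sym2 Face

/-- The square honeycomb of side `n` consists of the hexagons `(x, y)` with `0 ≤ x, y < n`;
its bottom hexagon is `(0, 0)` and its top hexagon is `(n - 1, n - 1)`.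
All the other hexagons of the lattice belong to the outer region. -/
def clip (n : ℕ) (c : Cell) : Face :=
  if 0 ≤ c.1 ∧ c.1 < (n : ℤ) ∧ 0 ≤ c.2 ∧ c.2 < (n : ℤ) then some c else none

/-- The vertices of the lattice at which a hexagon of the square of side `n` is present (and some
others), each of them given by the faces at its three corners in counterclockwise order. -/
def latticeVertices (n : ℕ) : Multiset (Face × Face × Face) :=
  (Finset.range (n + 1) ×ˢ Finset.range (n + 1)).val.map
      (fun c : ℕ × ℕ => (clip n ((c.1 : ℤ) - 1, (c.2 : ℤ) - 1), clip n ((c.1 : ℤ), (c.2 : ℤ) - 1),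
        clip n ((c.1 : ℤ) - 1, (c.2 : ℤ)))) +
  (Finset.range (n + 1) ×ˢ Finset.range (n + 1)).val.map
      (fun c : ℕ × ℕ => (clip n ((c.1 : ℤ), (c.2 : ℤ) - 1), clip n ((c.1 : ℤ), (c.2 : ℤ)),
        clip n ((c.1 : ℤ) - 1, (c.2 : ℤ))))

/-- The honeycomb network `H_n`, for `n ≥ 2`, with one variable for the colour of each edge.  Its
vertices are the lattice vertices at which three different faces meet.  At the other lattice vertices
of the perimeter only one hexagon of the square meets the outer region: these are binary
vertices, where the two incident edges are merged into a single edge. -/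
def honeycomb (n : ℕ) : Net Edge :=
  ((latticeVertices n).filter (fun t => t.1 ≠ t.2.1 ∧ t.2.1 ≠ t.2.2 ∧ t.2.2 ≠ t.1)).map
    (fun t => vert s(t.1, t.2.1) s(t.2.1, t.2.2) s(t.2.2, t.1))

/-- The edge between two hexagons. -/
def inner (c d : Cell) : Edge := s(some c, some d)

/-- The edge between a hexagon on the perimeter and the outer region. -/
def outer (c : Cell) : Edge := s(some c, none)

/-- The upper side of the top hexagon of `H_n`. -/
def topEdge (n : ℕ) : Edge := outer ((n : ℤ) - 1, (n : ℤ) - 1)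

/-- The edges at which `H_n` is recoupled.  The upper perimeter of hexagons (the crown) is formed by
the hexagons `(n - 1, y)` and `(x, n - 1)`.  The edges are: the central one, between the two crown
hexagons below the top hexagon; on each side, the edges between the following consecutive
crown hexagons; on each side, the bottom edge of the most lateral hexagon. -/
def crownEdges (n : ℕ) : List Edge :=
  [inner ((n : ℤ) - 1, (n : ℤ) - 2) ((n : ℤ) - 2, (n : ℤ) - 1)] ++
  (List.range (n - 2)).map
    (fun y : ℕ => inner ((n : ℤ) - 1, (y : ℤ) + 1) ((n : ℤ) - 1, (y : ℤ))) ++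
  (List.range (n - 2)).map
    (fun x : ℕ => inner ((x : ℤ) + 1, (n : ℤ) - 1) ((x : ℤ), (n : ℤ) - 1)) ++
  [inner ((n : ℤ) - 1, 0) ((n : ℤ) - 2, 0), inner (0, (n : ℤ) - 1) (0, (n : ℤ) - 2)]

/-- The outer sides of the crown hexagons which become the bubbles of `BO_n`, that is, of the
crown hexagons other than the top one, its two crown neighbours, and the two most lateral ones. -/
def bubbleEdges (n : ℕ) : List Edge :=
  (List.range (n - 3)).map (fun y : ℕ => outer ((n : ℤ) - 1, (y : ℤ) + 1)) ++
  (List.range (n - 3)).map (fun x : ℕ => outer ((x : ℤ) + 1, (n : ℤ) - 1))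

/-! ### Formal sums of networks and the moves of recoupling theory -/

/-- Colour variables: the given colours of the edges of the honeycomb, and names for the indices of
summation. -/
abbrev Colour : Type := Edge ⊕ ℕ

/-- The coefficients produced by the moves. -/
inductive Coeff : Type
  /-- The `6j`-symbol with rows `a b i` and `c d j`. -/
  | sixJ (a b i c d j : Colour)
  /-- The value of the theta network. -/
  | theta (a b c : Colour)
  /-- The inverse of the quantum dimension. -/
  | invDelta (a : Colour)
  /-- The value of the tetrahedron whose vertices are `a b c`, `a e f`, `b f d`, `c d e`. -/
  | tet (a b c d e f : Colour)

/-- Substitution of colours in a coefficient. -/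
def Coeff.map (r : Colour → Colour) : Coeff → Coeff
  | .sixJ a b i c d j => .sixJ (r a) (r b) (r i) (r c) (r d) (r j)
  | .theta a b c => .theta (r a) (r b) (r c)
  | .invDelta a => .invDelta (r a)
  | .tet a b c d e f => .tet (r a) (r b) (r c) (r d) (r e) (r f)

/-- The colours which occur in a coefficient. -/
def Coeff.colours : Coeff → List Colour
  | .sixJ a b i c d j => [a, b, i, c, d, j]
  | .theta a b c => [a, b, c]
  | .invDelta a => [a]
  | .tet a b c d e f => [a, b, c, d, e, f]

/-- The formal expression
`∑ (over all compatible colours of the indices in sums) (∏ coeffs) * net`. -/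
structure Expr where
  /-- The remaining network. -/
  net : Net Colour
  /-- The indices of summation. -/
  sums : Finset Colour
  /-- The factors of the coefficient. -/
  coeffs : Multiset Coeff

/-- The variable `i` is not used in the expression. -/
def Expr.Fresh (X : Expr) (i : Colour) : Prop :=
  i ∉ X.sums ∧ (∀ v ∈ X.net, i ∉ v) ∧ ∀ t ∈ X.coeffs, i ∉ t.colours

/-- Recoupling at the edge `j`: an edge `j` that joins the vertices with further edges `a, b` and
`c, d` is replaced, with a new summation over `i` and a `6j`-symbol, by an edge `i` that joins
vertices with further edges `b, c` and `a, d`. -/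
inductive Recouple : Colour → Expr → Expr → Prop
  | mk (a b c d i j : Colour) (R : Net Colour) (S : Finset Colour) (K : Multiset Coeff)
      (hi : Expr.Fresh ⟨vert j b a ::ₘ vert j d c ::ₘ R, S, K⟩ i) :
      Recouple j
        ⟨vert j b a ::ₘ vert j d c ::ₘ R, S, K⟩
        ⟨vert i c b ::ₘ vert i a d ::ₘ R, insert i S, Coeff.sixJ a b i c d j ::ₘ K⟩

/-- The diagrammatic Schur lemma: a bubble with sides `x, y`, entered by the edges `p` and `q`, is
replaced by a single edge, with the factor `θ(p, x, y) / Δ_p` and the Kronecker delta of `p` and `q`.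
Here `q` is an index of summation, and the delta removes the summation over `q`. -/
inductive Burst : Expr → Expr → Prop
  | mk (p q x y : Colour) (R : Net Colour) (S : Finset Colour) (K : Multiset Coeff)
      (hpq : p ≠ q) (hq : q ∈ S) :
      Burst
        ⟨vert p x y ::ₘ vert q y x ::ₘ R, S, K⟩
        ⟨R.map (fun z => if z = q then p else z), S.erase q,
          Coeff.theta p x y ::ₘ Coeff.invDelta p ::ₘ
            K.map (Coeff.map (fun z => if z = q then p else z))⟩

/-- The network contains a bubble. -/
def HasBubble (N : Net Colour) : Prop :=
  ∃ (p q x y : Colour) (R : Net Colour), N = vert p x y ::ₘ vert q y x ::ₘ R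

/-- The bubble move at the edge `e`: a triangle with sides `a, d, e`, entered by the edges `b`
(between `a` and `e`), `c` (between `e` and `d`) and `f` (between `a` and `d`), is replaced by a
vertex.  There is no summation. -/
inductive BubbleMove : Colour → Expr → Expr → Prop
  | mk (a b c d e f : Colour) (R : Net Colour) (S : Finset Colour) (K : Multiset Coeff) :
      BubbleMove e
        ⟨vert b a e ::ₘ vert c e d ::ₘ vert f d a ::ₘ R, S, K⟩
        ⟨vert b f c ::ₘ R, S,
          Coeff.sixJ a b f c d e ::ₘ Coeff.invDelta f ::ₘ Coeff.theta a d f ::ₘ K⟩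

/-- Evaluation of a tetrahedron. -/
inductive EvalTet : Expr → Expr → Prop
  | mk (a b c d e f : Colour) (S : Finset Colour) (K : Multiset Coeff) :
      EvalTet
        ⟨{vert a b c, vert a e f, vert b f d, vert c d e}, S, K⟩
        ⟨0, S, Coeff.tet a b c d e f ::ₘ K⟩

/-- Successive application of a move at each member of a list. -/
inductive Successively (move : Colour → Expr → Expr → Prop) : List Colour → Expr → Expr → Prop
  | nil (X : Expr) : Successively move [] X X
  | cons (e : Colour) (l : List Colour) (X Y Z : Expr)
      (h : move e X Y) (t : Successively move l Y Z) : Successively move (e :: l) X Z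

/-! ### The algorithm -/

/-- One passage through the loop of the algorithm, from `H_n` with the colours `col` to `H_(n-1)`
with the colours `col'`: the bubble move at the top; recoupling at the edges that connect the
crown to the bulk; removal of all the bubbles through the Schur lemma; the bubble moves
which rewrite `BO_n`.  The result is `H_(n-1)`, which inherits the colours of the bulk. -/
def Pass (n : ℕ) (col col' : Edge → Colour) (X Y : Expr) : Prop :=
  ∃ X₁ X₂ X₃ : Expr,
    BubbleMove (col (topEdge n)) X X₁ ∧
    Successively Recouple ((crownEdges n).map col) X₁ X₂ ∧
    Relation.ReflTransGen Burst X₂ X₃ ∧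
    ¬ HasBubble X₃.net ∧
    Successively BubbleMove ((bubbleEdges n).map col) X₃ Y ∧
    Y.net = (honeycomb (n - 1)).map col' ∧
    ∀ c d : Cell, col' (inner c d) = col (inner c d)

/-- A complete run of the algorithm, from `H_n` with the colours `col`: the loop is repeated while
`n ≥ 3`; then `H_2` is turned into a tetrahedron by the bubble move at the top, and the tetrahedron
is evaluated. -/
inductive Run : ℕ → (Edge → Colour) → Expr → Expr → Prop
  | last (col : Edge → Colour) (X Y Z : Expr)
      (h : BubbleMove (col (topEdge 2)) X Y) (ht : EvalTet Y Z) : Run 2 col X Z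
  | loop (n : ℕ) (hn : 3 ≤ n) (col col' : Edge → Colour) (X Y Z : Expr)
      (h : Pass n col col' X Y) (t : Run (n - 1) col' Y Z) : Run n col X Z

/-- The algorithm, applied to `H_n` with arbitrary colours, can return the evaluation formula
`∑ (over the indices in S) ∏ K`. -/
def Evaluates (n : ℕ) (S : Finset Colour) (K : Multiset Coeff) : Prop :=
  Run n Sum.inl ⟨(honeycomb n).map Sum.inl, ∅, 0⟩ ⟨0, S, K⟩

end HoneycombNet

/-!
The number of summations does not depend on the run because it can be read off from the number of
vertices.  A recoupling adds one summation and keeps the number of vertices, an application of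
the Schur lemma removes one summation and two vertices, and a bubble move only removes two vertices.
As `H_n` has `2 n ^ 2 - 2` vertices (`card_honeycomb`), a passage from `H_n` to `H_(n-1)` removes
`4 n - 2` of them, `2 + 4 (n - 3)` by bubble moves; hence exactly four bubbles are burst, whatever
their order, and the `2 n - 1` recouplings leave `2 n - 5` new summations (`Pass.count`).  The final
steps for `H_2` add none, so `a_n = (n - 2) ^ 2`.

That a run exists is shown by following the network explicitly.  The trivalent vertices of `H_n` are
the tops of all the hexagons but the top one and the bottoms of all of them but the bottom one
(`honeycomb_eq_sum`).  After the bubble move at the top, the edges of `crownEdges` have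
pairwise disjoint pairs of ends (`exists_honeycomb_eq_topTriangle_add`), so the recouplings do not
interfere with one another.  They create new edges between the bulk and the outer region, and
exactly four bubbles (`crownSites_after`): the two lateral hexagons and the two crown neighbours
of the top hexagon.  Once these are burst, every pair of faces shares at most one edge,
so that the network is again described by the triples of faces at its vertices, with an
injective colouring (`map_renameAll_besideBubbles`).  A bubble would need two vertices with the
same three faces in opposite cyclic orders, which the positions of the hexagons exclude
(`not_hasBubble_of_oriented`, `oriented_of_mem`).  The remaining crown hexagons are disjoint
triangles, and the bubble moves replace them by the vertices of `H_(n-1)` (`triangles_after`).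

For the induction over the passages, the invariant is that the colouring is injective and that
infinitely many colours are free (`exists_pass`).
-/

namespace HoneycombNet

/-! ### Trivalent vertices and renaming of colours -/

lemma vert_rotate {α : Type} (a b c : α) : vert a b c = vert b c a :=
  Cycle.coe_eq_coe.mpr ⟨1, rfl⟩

lemma map_vert {α β : Type} (f : α → β) (a b c : α) :
    (vert a b c).map f = vert (f a) (f b) (f c) := rfl

lemma mem_vert {α : Type} {i a b c : α} : i ∈ vert a b c ↔ i = a ∨ i = b ∨ i = c := by
  simp [vert]

lemma vert_eq_vert_iff {α : Type} {a b c p x y : α} :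
    vert a b c = vert p x y ↔ (a = p ∧ b = x ∧ c = y) ∨ (b = p ∧ c = x ∧ a = y) ∨
      (c = p ∧ a = x ∧ b = y) := by
  constructor
  · intro h
    obtain ⟨k, hk⟩ := Cycle.coe_eq_coe.mp h
    rw [← List.rotate_mod] at hk
    have : k % 3 < 3 := Nat.mod_lt _ (by norm_num)
    simp only [List.length_cons, List.length_nil] at hk
    norm_num at hk
    interval_cases k % 3 <;> simp [List.rotate] at hk <;> tauto
  · rintro (⟨rfl, rfl, rfl⟩ | ⟨rfl, rfl, rfl⟩ | ⟨rfl, rfl, rfl⟩)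
    · rfl
    · exact vert_rotate _ _ _
    · rw [vert_rotate, vert_rotate]

lemma Net.map_add {α β : Type} (f : α → β) (M N : Net α) :
    Net.map f (M + N) = Net.map f M + Net.map f N := Multiset.map_add _ _ _

lemma Net.map_singleton {α β : Type} (f : α → β) (a b c : α) :
    Net.map f {vert a b c} = {vert (f a) (f b) (f c)} := rfl

lemma Net.map_sum {α β ι : Type} (f : α → β) (s : Finset ι) (N : ι → Net α) :
    Net.map f (∑ i ∈ s, N i) = ∑ i ∈ s, Net.map f (N i) :=
  _root_.map_sum (Multiset.mapAddMonoidHom (Cycle.map f)) N s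

lemma Net.map_map {α β γ : Type} (g : β → γ) (f : α → β) (N : Net α) :
    Net.map g (Net.map f N) = Net.map (fun z => g (f z)) N := by
  simp only [Net.map, Multiset.map_map]
  refine Multiset.map_congr rfl fun v _ => ?_
  induction v using Quotient.inductionOn with
  | _ l => exact congrArg _ (List.map_map ..)

/-- Replacement of `q` by `p`. -/
def rename {α : Type} [DecidableEq α] (p q : α) : α → α := fun z => if z = q then p else z

/-! ### Existence of the moves -/

lemma Coeff.colours_map (r : Colour → Colour) (t : Coeff) :
    (t.map r).colours = t.colours.map r := by
  cases t <;> rfl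

/-- The colours around an edge `j` that is going to be recoupled, and the name `i` of the edge
which replaces it. -/
structure RecouplingSite (α : Type) where
  (a b c d i j : α)

/-- The two vertices at the ends of the edge, before recoupling. -/
def RecouplingSite.before {α : Type} (t : RecouplingSite α) : Net α :=
  {vert t.j t.b t.a} + {vert t.j t.d t.c}

/-- The two vertices after recoupling. -/
def RecouplingSite.after {α : Type} (t : RecouplingSite α) : Net α :=
  {vert t.i t.c t.b} + {vert t.i t.a t.d}

/-- Recoupling at edges with pairwise disjoint pairs of ends can be done in any order. -/
lemma exists_successively_recouple {α : Type} {ρ : α → Colour} (hρ : Function.Injective ρ)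
    (l : List (RecouplingSite α)) (X : Expr) (R : Net α)
    (hX : X.net = Net.map ρ ((l.map RecouplingSite.before).sum + R))
    (hl : (l.map RecouplingSite.i).Nodup) (hfresh : ∀ t ∈ l, X.Fresh (ρ t.i)) :
    ∃ Y : Expr, Successively Recouple (l.map fun t => ρ t.j) X Y ∧
      Y.net = Net.map ρ ((l.map RecouplingSite.after).sum + R) ∧
      (∀ t ∈ l, ρ t.i ∈ Y.sums) ∧ X.sums ⊆ Y.sums ∧
      ∀ k, X.Fresh k → (∀ t ∈ l, k ≠ ρ t.i) → Y.Fresh k := by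
  induction l generalizing X R with
  | nil => exact ⟨X, .nil X, hX, by simp, subset_rfl, fun k hk _ => hk⟩
  | cons t l ih =>
    obtain ⟨N, S, K⟩ := X
    simp only [List.map_cons, List.sum_cons, List.nodup_cons, List.mem_map, not_exists,
      not_and] at hX hl
    have hN : N = vert (ρ t.j) (ρ t.b) (ρ t.a) ::ₘ vert (ρ t.j) (ρ t.d) (ρ t.c) ::ₘ
        Net.map ρ ((l.map RecouplingSite.before).sum + R) := by
      rw [hX]
      simp only [RecouplingSite.before, Net.map_add, Net.map_singleton,
        ← Multiset.singleton_add]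
      abel
    subst hN
    have hi := hfresh t (by simp)
    have key : ∀ k, Expr.Fresh ⟨vert (ρ t.j) (ρ t.b) (ρ t.a) ::ₘ
        vert (ρ t.j) (ρ t.d) (ρ t.c) ::ₘ
        Net.map ρ ((l.map RecouplingSite.before).sum + R), S, K⟩ k → k ≠ ρ t.i →
        Expr.Fresh ⟨vert (ρ t.i) (ρ t.c) (ρ t.b) ::ₘ vert (ρ t.i) (ρ t.a) (ρ t.d) ::ₘ
          Net.map ρ ((l.map RecouplingSite.before).sum + R), insert (ρ t.i) S,
          Coeff.sixJ (ρ t.a) (ρ t.b) (ρ t.i) (ρ t.c) (ρ t.d) (ρ t.j) ::ₘ K⟩ k := by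
      rintro k ⟨h1, h2, h3⟩ hk
      simp only [Multiset.mem_cons, forall_eq_or_imp, mem_vert, not_or] at h2
      refine ⟨by simp [hk, h1], ?_, ?_⟩
      · simp only [Multiset.mem_cons, forall_eq_or_imp, mem_vert, not_or]
        tauto
      · simp only [Multiset.mem_cons, forall_eq_or_imp]
        refine ⟨?_, h3⟩
        simp [Coeff.colours]
        tauto
    obtain ⟨Y, hY, hnet, hmem, hsub, hfr⟩ := ih
      ⟨vert (ρ t.i) (ρ t.c) (ρ t.b) ::ₘ vert (ρ t.i) (ρ t.a) (ρ t.d) ::ₘ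
        Net.map ρ ((l.map RecouplingSite.before).sum + R), insert (ρ t.i) S,
        Coeff.sixJ (ρ t.a) (ρ t.b) (ρ t.i) (ρ t.c) (ρ t.d) (ρ t.j) ::ₘ K⟩
      (t.after + R)
      (by
        simp only [RecouplingSite.after, Net.map_add, Net.map_singleton,
          ← Multiset.singleton_add]
        abel)
      hl.2
      (fun t' ht' => key _ (hfresh t' (by simp [ht'])) fun h => hl.1 t' ht' (hρ h))
    refine ⟨Y, .cons _ _ _ _ _ (.mk _ _ _ _ _ _ _ _ _ hi) hY, ?_, ?_, ?_, ?_⟩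
    · rw [hnet]
      simp only [List.map_cons, List.sum_cons]
      congr 1
      abel
    · simp only [List.mem_cons, forall_eq_or_imp]
      exact ⟨hsub (Finset.mem_insert_self _ _), hmem⟩
    · exact (Finset.subset_insert _ _).trans hsub
    · intro k hk hne
      simp only [List.mem_cons, forall_eq_or_imp] at hne
      exact hfr k (key k hk hne.1) hne.2

/-- The edges of a triangular face with sides `a, d, e` and the edges `b, c, f` entering it. -/
structure Triangle (α : Type) where
  (a b c d e f : α)

/-- The three vertices of the triangle. -/
def Triangle.before {α : Type} (t : Triangle α) : Net α :=
  {vert t.b t.a t.e} + {vert t.c t.e t.d} + {vert t.f t.d t.a}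

/-- The vertex which replaces the triangle. -/
def Triangle.after {α : Type} (t : Triangle α) : Net α :=
  {vert t.b t.f t.c}

lemma exists_successively_bubbleMove {α : Type} (ρ : α → Colour)
    (l : List (Triangle α)) (X : Expr) (R : Net α)
    (hX : X.net = Net.map ρ ((l.map Triangle.before).sum + R)) :
    ∃ Y : Expr, Successively BubbleMove (l.map fun t => ρ t.e) X Y ∧
      Y.net = Net.map ρ ((l.map Triangle.after).sum + R) ∧ Y.sums = X.sums ∧
      ∀ k, X.Fresh k → Y.Fresh k := by
  induction l generalizing X R with
  | nil => exact ⟨X, .nil X, hX, rfl, fun k hk => hk⟩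
  | cons t l ih =>
    obtain ⟨N, S, K⟩ := X
    simp only [List.map_cons, List.sum_cons] at hX
    have hN : N = vert (ρ t.b) (ρ t.a) (ρ t.e) ::ₘ vert (ρ t.c) (ρ t.e) (ρ t.d) ::ₘ
        vert (ρ t.f) (ρ t.d) (ρ t.a) ::ₘ Net.map ρ ((l.map Triangle.before).sum + R) := by
      rw [hX]
      simp only [Triangle.before, Net.map_add, Net.map_singleton, ← Multiset.singleton_add]
      abel
    subst hN
    obtain ⟨Y, hY, hnet, hS, hfr⟩ := ih
      ⟨vert (ρ t.b) (ρ t.f) (ρ t.c) ::ₘ Net.map ρ ((l.map Triangle.before).sum + R), S,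
        Coeff.sixJ (ρ t.a) (ρ t.b) (ρ t.f) (ρ t.c) (ρ t.d) (ρ t.e) ::ₘ
          Coeff.invDelta (ρ t.f) ::ₘ Coeff.theta (ρ t.a) (ρ t.d) (ρ t.f) ::ₘ K⟩
      (t.after + R)
      (by
        simp only [Triangle.after, Net.map_add, Net.map_singleton, ← Multiset.singleton_add]
        abel)
    refine ⟨Y, .cons _ _ _ _ _ (.mk _ _ _ _ _ _ _ _ _) hY, ?_, hS, ?_⟩
    · rw [hnet]
      simp only [List.map_cons, List.sum_cons]
      congr 1
      abel
    · rintro k ⟨h1, h2, h3⟩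
      simp only [Multiset.mem_cons, forall_eq_or_imp, mem_vert, not_or] at h2
      refine hfr k ⟨h1, ?_, ?_⟩
      · simp only [Multiset.mem_cons, forall_eq_or_imp, mem_vert, not_or]
        tauto
      · simp only [Multiset.mem_cons, forall_eq_or_imp]
        refine ⟨?_, ?_, ?_, h3⟩ <;> simp [Coeff.colours] <;> tauto

lemma exists_burst {α : Type} [DecidableEq α] {ρ : α → Colour} (hρ : Function.Injective ρ)
    {X : Expr} {p q x y : α} {R : Net α}
    (hX : X.net = Net.map ρ ({vert p x y} + {vert q y x} + R)) (hpq : p ≠ q)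
    (hq : ρ q ∈ X.sums) :
    ∃ Y : Expr, Burst X Y ∧ Y.net = Net.map ρ (Net.map (rename p q) R) ∧
      Y.sums = X.sums.erase (ρ q) ∧ ∀ k, X.Fresh k → Y.Fresh k := by
  obtain ⟨N, S, K⟩ := X
  have hN : N = vert (ρ p) (ρ x) (ρ y) ::ₘ vert (ρ q) (ρ y) (ρ x) ::ₘ Net.map ρ R := by
    simp only at hX
    rw [hX]
    simp only [Net.map_add, Net.map_singleton, ← Multiset.singleton_add]
    abel
  subst hN
  refine ⟨_, .mk _ _ _ _ _ _ _ (hρ.ne hpq) hq, ?_, rfl, ?_⟩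
  · simp only [Net.map_map]
    congr 1
    funext z
    by_cases hz : z = q <;> simp [rename, hz, hρ.eq_iff]
  · rintro k ⟨h1, h2, h3⟩
    simp only [Multiset.mem_cons, forall_eq_or_imp, mem_vert, not_or] at h2
    obtain ⟨⟨hp, hx, hy⟩, ⟨hkq, -⟩, hR⟩ := h2
    -- a renamed colour is either `p` or an old colour
    have himg : ∀ z, z ≠ k → (if z = ρ q then ρ p else z) ≠ k := by
      intro z hz
      split_ifs
      · exact fun h => hp h.symm
      · exact hz
    refine ⟨fun h => h1 (Finset.mem_of_mem_erase h), ?_, ?_⟩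
    · intro v hv hk
      obtain ⟨u, hu, rfl⟩ := Multiset.mem_map.mp hv
      obtain ⟨z, hz, hzk⟩ := Cycle.mem_map.mp hk
      exact himg z (fun h => hR u hu (h ▸ hz)) hzk
    · simp only [Multiset.mem_cons, forall_eq_or_imp, Multiset.mem_map, forall_exists_index,
        and_imp, forall_apply_eq_imp_iff₂]
      refine ⟨by simp [Coeff.colours, hp, hx, hy], by simp [Coeff.colours, hp], ?_⟩
      intro t ht hk
      rw [Coeff.colours_map, List.mem_map] at hk
      obtain ⟨z, hz, hzk⟩ := hk
      exact himg z (fun h => h3 t ht (h ▸ hz)) hzk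

/-! ### The vertices of the honeycomb -/

/-- The vertex at which the faces `f, g, h` meet, in counterclockwise order. -/
def tri (f g h : Face) : Cycle Edge := vert s(f, g) s(g, h) s(h, f)

/-- The hexagon with coordinates `x, y`, as a face. -/
abbrev hex (x y : ℤ) : Face := some (x, y)

lemma tri_rotate (f g h : Face) : tri f g h = tri g h f := vert_rotate _ _ _

/-- The vertex of `H_n` at the top of the hexagon `(x, y)`. -/
def topVertex (n x y : ℕ) : Cycle Edge :=
  tri (clip n ((x : ℤ), (y : ℤ))) (clip n ((x : ℤ) + 1, (y : ℤ))) (clip n ((x : ℤ), (y : ℤ) + 1))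

/-- The vertex of `H_n` at the bottom of the hexagon `(x, y)`. -/
def bottomVertex (n x y : ℕ) : Cycle Edge :=
  tri (clip n ((x : ℤ), (y : ℤ))) (clip n ((x : ℤ) - 1, (y : ℤ))) (clip n ((x : ℤ), (y : ℤ) - 1))

lemma clip_eq_clip_iff {n : ℕ} {c d : Cell} : clip n c = clip n d ↔ c = d ∨
    (¬ (0 ≤ c.1 ∧ c.1 < (n : ℤ) ∧ 0 ≤ c.2 ∧ c.2 < (n : ℤ)) ∧
      ¬ (0 ≤ d.1 ∧ d.1 < (n : ℤ) ∧ 0 ≤ d.2 ∧ d.2 < (n : ℤ))) := by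
  unfold clip
  split_ifs with h1 h2 h2
  · simp [h1]
  · simp only [false_iff, not_or]
    exact ⟨fun h => h2 (h ▸ h1), by tauto⟩
  · simp only [false_iff, not_or]
    exact ⟨fun h => h1 (h ▸ h2), by tauto⟩
  · simp [h1, h2]

lemma clip_of_mem {n : ℕ} {x y : ℤ} (h : 0 ≤ x ∧ x < (n : ℤ) ∧ 0 ≤ y ∧ y < (n : ℤ)) :
    clip n (x, y) = hex x y := if_pos h

lemma clip_of_notMem {n : ℕ} {x y : ℤ} (h : ¬ (0 ≤ x ∧ x < (n : ℤ) ∧ 0 ≤ y ∧ y < (n : ℤ))) :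
    clip n (x, y) = none := if_neg h

/-- The coordinates of the hexagons of the square of side `n`. -/
abbrev square (n : ℕ) : Finset (ℕ × ℕ) := Finset.range n ×ˢ Finset.range n

lemma map_val_eq_sum {ι β : Type} (s : Finset ι) (v : ι → β) :
    s.val.map v = ∑ c ∈ s, ({v c} : Multiset β) := by
  rw [← Multiset.sum_map_singleton (s.val.map v), Multiset.map_map]
  rfl

/-- Every hexagon of the square has a trivalent vertex at its top, except for the top hexagon, and
one at its bottom, except for the bottom hexagon; these are all the vertices. -/
lemma honeycomb_eq_sum (n : ℕ) : honeycomb (n + 1) =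
    ∑ c ∈ (square (n + 1)).erase (n, n), {topVertex (n + 1) c.1 c.2} +
    ∑ c ∈ (square (n + 1)).erase (0, 0), {bottomVertex (n + 1) c.1 c.2} := by
  unfold honeycomb latticeVertices
  rw [Multiset.filter_add, Multiset.map_add, Multiset.filter_map, Multiset.filter_map,
    Multiset.map_map, Multiset.map_map, ← Finset.filter_val, ← Finset.filter_val,
    map_val_eq_sum, map_val_eq_sum]
  congr 1
  · refine Finset.sum_nbij' (fun c => (c.1 - 1, c.2 - 1)) (fun c => (c.1 + 1, c.2 + 1))
      ?_ ?_ ?_ ?_ ?_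
    · rintro ⟨x, y⟩ h
      simp only [Function.comp, Finset.mem_filter, Finset.mem_product, Finset.mem_range, ne_eq,
        clip_eq_clip_iff, Prod.mk.injEq, Finset.mem_erase] at h ⊢
      omega
    · rintro ⟨x, y⟩ h
      simp only [Function.comp, Finset.mem_filter, Finset.mem_product, Finset.mem_range, ne_eq,
        clip_eq_clip_iff, Prod.mk.injEq, Finset.mem_erase] at h ⊢
      omega
    · rintro ⟨x, y⟩ h
      simp only [Function.comp, Finset.mem_filter, Finset.mem_product, Finset.mem_range, ne_eq,
        clip_eq_clip_iff, Prod.mk.injEq] at h ⊢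
      omega
    · rintro ⟨x, y⟩ h
      simp
    · rintro ⟨x, y⟩ h
      have hxy : 1 ≤ x ∧ 1 ≤ y := by
        simp only [Function.comp, Finset.mem_filter, Finset.mem_product, Finset.mem_range, ne_eq,
          clip_eq_clip_iff, Prod.mk.injEq] at h
        omega
      obtain ⟨x, rfl⟩ := Nat.exists_eq_add_of_le' hxy.1
      obtain ⟨y, rfl⟩ := Nat.exists_eq_add_of_le' hxy.2
      simp [topVertex, tri]
  · refine Finset.sum_congr ?_ ?_
    · ext ⟨x, y⟩
      simp only [Function.comp, Finset.mem_filter, Finset.mem_product, Finset.mem_range, ne_eq,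
        clip_eq_clip_iff, Prod.mk.injEq, Finset.mem_erase]
      omega
    · rintro ⟨x, y⟩ -
      exact congrArg _ (tri_rotate _ _ _)

lemma card_honeycomb (n : ℕ) : (honeycomb (n + 1)).card = 2 * ((n + 1) ^ 2 - 1) := by
  rw [honeycomb_eq_sum]
  simp [Multiset.card_sum, Finset.card_erase_of_mem]
  ring_nf

lemma sum_square_erase_top {M : Type} [AddCancelCommMonoid M] (n : ℕ) (f : ℕ → ℕ → M) :
    ∑ c ∈ (square (n + 1)).erase (n, n), f c.1 c.2 =
      ∑ x ∈ Finset.range n, ∑ y ∈ Finset.range n, f x y +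
        ∑ y ∈ Finset.range n, f n y + ∑ x ∈ Finset.range n, f x n := by
  have h := Finset.add_sum_erase (square (n + 1)) (fun c => f c.1 c.2) (a := (n, n)) (by simp)
  rw [Finset.sum_product] at h
  simp only [Finset.sum_range_succ, Finset.sum_add_distrib] at h
  apply add_left_cancel (a := f n n)
  rw [h]
  abel

lemma sum_square_erase_zero {M : Type} [AddCancelCommMonoid M] (n : ℕ) (f : ℕ → ℕ → M) :
    ∑ c ∈ (square (n + 2)).erase (0, 0), f c.1 c.2 =
      ∑ c ∈ (square (n + 1)).erase (0, 0), f c.1 c.2 +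
        ∑ y ∈ Finset.range (n + 1), f (n + 1) y + ∑ x ∈ Finset.range (n + 1), f x (n + 1) +
        f (n + 1) (n + 1) := by
  have h := Finset.add_sum_erase (square (n + 2)) (fun c => f c.1 c.2) (a := (0, 0)) (by simp)
  have h' := Finset.add_sum_erase (square (n + 1)) (fun c => f c.1 c.2) (a := (0, 0)) (by simp)
  rw [Finset.sum_product] at h h'
  simp only [Finset.sum_range_succ _ (n + 1), Finset.sum_add_distrib] at h
  apply add_left_cancel (a := f 0 0)
  rw [h, ← h']
  abel

/-- The part of `H_(m + 3)` which is not changed by a passage through the loop: the vertices that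
do not touch the crown. -/
def bulk (m : ℕ) : Net Edge :=
  ∑ x ∈ Finset.range (m + 1), ∑ y ∈ Finset.range (m + 1),
    {tri (hex x y) (hex (x + 1) y) (hex x (y + 1))} +
  ∑ c ∈ (square (m + 2)).erase (0, 0), {bottomVertex (m + 2) c.1 c.2}

lemma honeycomb_eq_bulk_add (m : ℕ) : honeycomb (m + 2) = bulk m +
    ∑ y ∈ Finset.range (m + 1), {tri (hex (m + 1) y) none (hex (m + 1) (y + 1))} +
    ∑ x ∈ Finset.range (m + 1), {tri (hex x (m + 1)) (hex (x + 1) (m + 1)) none} := by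
  have e1 : ∑ x ∈ Finset.range (m + 1), ∑ y ∈ Finset.range (m + 1),
      ({topVertex (m + 2) x y} : Net Edge) =
      ∑ x ∈ Finset.range (m + 1), ∑ y ∈ Finset.range (m + 1),
        {tri (hex x y) (hex (x + 1) y) (hex x (y + 1))} := by
    refine Finset.sum_congr rfl fun x hx => Finset.sum_congr rfl fun y hy => ?_
    rw [Finset.mem_range] at hx hy
    unfold topVertex
    rw [clip_of_mem (by omega), clip_of_mem (by omega), clip_of_mem (by omega)]
  have e2 : ∑ y ∈ Finset.range (m + 1), ({topVertex (m + 2) (m + 1) y} : Net Edge) =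
      ∑ y ∈ Finset.range (m + 1), {tri (hex (m + 1) y) none (hex (m + 1) (y + 1))} := by
    refine Finset.sum_congr rfl fun y hy => ?_
    rw [Finset.mem_range] at hy
    unfold topVertex
    rw [clip_of_mem (by omega), clip_of_notMem (by omega), clip_of_mem (by omega)]
    push_cast
    rfl
  have e3 : ∑ x ∈ Finset.range (m + 1), ({topVertex (m + 2) x (m + 1)} : Net Edge) =
      ∑ x ∈ Finset.range (m + 1), {tri (hex x (m + 1)) (hex (x + 1) (m + 1)) none} := by
    refine Finset.sum_congr rfl fun x hx => ?_
    rw [Finset.mem_range] at hx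
    unfold topVertex
    rw [clip_of_mem (by omega), clip_of_mem (by omega), clip_of_notMem (by omega)]
    push_cast
    rfl
  rw [honeycomb_eq_sum, sum_square_erase_top (m + 1) fun x y => {topVertex (m + 2) x y},
    e1, e2, e3, bulk]
  abel

/-- The bulk together with its border towards the crown. -/
lemma honeycomb_eq_bulk_add_crown (m : ℕ) : honeycomb (m + 3) = bulk m +
    (∑ y ∈ Finset.range (m + 1),
      {tri (hex (m + 1) y) (hex (m + 2) y) (hex (m + 1) (y + 1))} +
    ∑ x ∈ Finset.range (m + 1),
      {tri (hex x (m + 1)) (hex (x + 1) (m + 1)) (hex x (m + 2))} +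
    {tri (hex (m + 1) (m + 1)) (hex (m + 2) (m + 1)) (hex (m + 1) (m + 2))}) +
    (∑ y ∈ Finset.range (m + 2), {tri (hex (m + 2) y) none (hex (m + 2) (y + 1))} +
    ∑ x ∈ Finset.range (m + 2), {tri (hex x (m + 2)) (hex (x + 1) (m + 2)) none}) +
    (∑ y ∈ Finset.range (m + 1),
      {tri (hex (m + 2) (y + 1)) (hex (m + 1) (y + 1)) (hex (m + 2) y)} +
    {tri (hex (m + 2) 0) (hex (m + 1) 0) none} +
    ∑ x ∈ Finset.range (m + 1),
      {tri (hex (x + 1) (m + 2)) (hex x (m + 2)) (hex (x + 1) (m + 1))} +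
    {tri (hex 0 (m + 2)) none (hex 0 (m + 1))} +
    {tri (hex (m + 2) (m + 2)) (hex (m + 1) (m + 2)) (hex (m + 2) (m + 1))}) := by
  have e1 : ∑ x ∈ Finset.range (m + 2), ∑ y ∈ Finset.range (m + 2),
      ({topVertex (m + 3) x y} : Net Edge) =
      ∑ x ∈ Finset.range (m + 2), ∑ y ∈ Finset.range (m + 2),
        {tri (hex x y) (hex (x + 1) y) (hex x (y + 1))} := by
    refine Finset.sum_congr rfl fun x hx => Finset.sum_congr rfl fun y hy => ?_
    rw [Finset.mem_range] at hx hy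
    unfold topVertex
    rw [clip_of_mem (by omega), clip_of_mem (by omega), clip_of_mem (by omega)]
  have e2 : ∑ y ∈ Finset.range (m + 2), ({topVertex (m + 3) (m + 2) y} : Net Edge) =
      ∑ y ∈ Finset.range (m + 2), {tri (hex (m + 2) y) none (hex (m + 2) (y + 1))} := by
    refine Finset.sum_congr rfl fun y hy => ?_
    rw [Finset.mem_range] at hy
    unfold topVertex
    rw [clip_of_mem (by omega), clip_of_notMem (by omega), clip_of_mem (by omega)]
    push_cast
    rfl
  have e3 : ∑ x ∈ Finset.range (m + 2), ({topVertex (m + 3) x (m + 2)} : Net Edge) =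
      ∑ x ∈ Finset.range (m + 2), {tri (hex x (m + 2)) (hex (x + 1) (m + 2)) none} := by
    refine Finset.sum_congr rfl fun x hx => ?_
    rw [Finset.mem_range] at hx
    unfold topVertex
    rw [clip_of_mem (by omega), clip_of_mem (by omega), clip_of_notMem (by omega)]
    push_cast
    rfl
  have e4 : ∑ c ∈ (square (m + 2)).erase (0, 0), ({bottomVertex (m + 3) c.1 c.2} : Net Edge) =
      ∑ c ∈ (square (m + 2)).erase (0, 0), {bottomVertex (m + 2) c.1 c.2} := by
    refine Finset.sum_congr rfl ?_
    rintro ⟨x, y⟩ h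
    simp only [Finset.mem_erase, Finset.mem_product, Finset.mem_range] at h
    have hc : ∀ u v : ℤ, u ≤ x → v ≤ y → clip (m + 3) (u, v) = clip (m + 2) (u, v) := by
      intro u v hu hv
      unfold clip
      congr 1
      simp only [eq_iff_iff]
      omega
    unfold bottomVertex
    rw [hc _ _ le_rfl le_rfl, hc _ _ (by omega) le_rfl, hc _ _ le_rfl (by omega)]
  have e5 : ∑ y ∈ Finset.range (m + 2), ({bottomVertex (m + 3) (m + 2) y} : Net Edge) =
      ∑ y ∈ Finset.range (m + 1),
        {tri (hex (m + 2) (y + 1)) (hex (m + 1) (y + 1)) (hex (m + 2) y)} +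
      {tri (hex (m + 2) 0) (hex (m + 1) 0) none} := by
    rw [Finset.sum_range_succ']
    congr 1
    · refine Finset.sum_congr rfl fun y hy => ?_
      rw [Finset.mem_range] at hy
      unfold bottomVertex
      rw [clip_of_mem (by omega), clip_of_mem (by omega), clip_of_mem (by omega)]
      congr 4 <;> (push_cast; ring)
    · unfold bottomVertex
      rw [clip_of_mem (by omega), clip_of_mem (by omega), clip_of_notMem (by omega)]
      congr 4; push_cast; ring
  have e6 : ∑ x ∈ Finset.range (m + 2), ({bottomVertex (m + 3) x (m + 2)} : Net Edge) =
      ∑ x ∈ Finset.range (m + 1),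
        {tri (hex (x + 1) (m + 2)) (hex x (m + 2)) (hex (x + 1) (m + 1))} +
      {tri (hex 0 (m + 2)) none (hex 0 (m + 1))} := by
    rw [Finset.sum_range_succ']
    congr 1
    · refine Finset.sum_congr rfl fun x hx => ?_
      rw [Finset.mem_range] at hx
      unfold bottomVertex
      rw [clip_of_mem (by omega), clip_of_mem (by omega), clip_of_mem (by omega)]
      congr 4 <;> (push_cast; ring)
    · unfold bottomVertex
      rw [clip_of_mem (by omega), clip_of_notMem (by omega), clip_of_mem (by omega)]
      congr 4; push_cast; ring
  have e7 : bottomVertex (m + 3) (m + 2) (m + 2) =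
      tri (hex (m + 2) (m + 2)) (hex (m + 1) (m + 2)) (hex (m + 2) (m + 1)) := by
    unfold bottomVertex
    rw [clip_of_mem (by omega), clip_of_mem (by omega), clip_of_mem (by omega)]
    congr 3 <;> (push_cast; ring)
  rw [honeycomb_eq_sum, sum_square_erase_top (m + 2) fun x y => {topVertex (m + 3) x y},
    sum_square_erase_zero (m + 1) fun x y => {bottomVertex (m + 3) x y}, e1, e2, e3, e4, e5, e6,
    e7, bulk]
  simp only [Finset.sum_range_succ _ (m + 1), Finset.sum_add_distrib]
  push_cast
  simp only [show ((m : ℤ) + 1 + 1) = m + 2 by ring]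
  abel

/-! ### Recoupling of the crown -/

lemma sum_map_range {M : Type} [AddCommMonoid M] (n : ℕ) (f : ℕ → M) :
    ((List.range n).map f).sum = ∑ i ∈ Finset.range n, f i := rfl

/-- The edges that occur in a passage through the loop: the old edges of the honeycomb, and the
new edges created by recoupling. -/
abbrev Label : Type := Edge ⊕ Edge

/-- The old edge between two faces. -/
def oldEdge (f g : Face) : Label := Sum.inl s(f, g)

/-- A new edge.  If it survives the Schur lemma, it separates the face `f` from the outer
region. -/
def newEdge (f : Face) : Label := Sum.inr s(f, none)

lemma oldEdge_comm (f g : Face) : oldEdge f g = oldEdge g f := congrArg _ Sym2.eq_swap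

lemma newEdge_inj {f g : Face} : newEdge f = newEdge g ↔ f = g := by
  simp only [newEdge, Sum.inr.injEq, Sym2.congr_left]

lemma oldEdge_ne_newEdge (f g h : Face) : oldEdge f g ≠ newEdge h := Sum.inl_ne_inr

/-- Recoupling at the edge between `l` and `r`, which ends at the faces `s` and `t`. -/
def site (l r s t : Face) (i : Label) : RecouplingSite Label where
  a := oldEdge s l
  b := oldEdge r s
  c := oldEdge t r
  d := oldEdge l t
  i := i
  j := oldEdge l r

lemma site_before (l r s t : Face) (i : Label) :
    (site l r s t i).before = Net.map Sum.inl ({tri l r s} + {tri r l t}) := by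
  rw [Net.map_add, tri, tri, Net.map_singleton, Net.map_singleton, Sym2.eq_swap (a := r) (b := l)]
  rfl

lemma site_after (l r s t : Face) (i : Label) :
    (site l r s t i).after =
      {vert i (oldEdge t r) (oldEdge r s)} + {vert i (oldEdge s l) (oldEdge l t)} := rfl

/-- The recouplings of `H_(m + 3)`, in the order of `crownEdges`.  The new edges at the right, and
those at the left but the last one, are named after the bulk hexagon which they separate from the
outer region. The last new edge at the left, the central new edge and the two lateral ones are
duplicates, which will be removed by the Schur lemma; they are named after hexagons of the crown. -/
def crownSites (m : ℕ) : List (RecouplingSite Label) :=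
  [site (hex (m + 2) (m + 1)) (hex (m + 1) (m + 2)) (hex (m + 1) (m + 1)) none
    (newEdge (hex (m + 2) (m + 2)))] ++
  (List.range (m + 1)).map (fun y : ℕ =>
    site (hex (m + 2) (y + 1)) (hex (m + 2) y) none (hex (m + 1) (y + 1))
      (newEdge (hex (m + 1) (y + 1)))) ++
  (List.range (m + 1)).map (fun x : ℕ =>
    site (hex (x + 1) (m + 2)) (hex x (m + 2)) (hex (x + 1) (m + 1)) none
      (newEdge (hex (x + 1) (if x = m then m + 2 else m + 1)))) ++
  [site (hex (m + 2) 0) (hex (m + 1) 0) none (hex (m + 1) 1) (newEdge (hex (m + 2) 0)),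
    site (hex 0 (m + 2)) (hex 0 (m + 1)) (hex 1 (m + 1)) none (newEdge (hex 0 (m + 2)))]

lemma crownSites_edges (m : ℕ) :
    (crownSites m).map RecouplingSite.j = (crownEdges (m + 3)).map Sum.inl := by
  have h1 : ((m + 3 : ℕ) : ℤ) - 1 = m + 2 := by push_cast; ring
  have h2 : ((m + 3 : ℕ) : ℤ) - 2 = m + 1 := by push_cast; ring
  simp only [crownSites, crownEdges, h1, h2, List.map_append, List.map_map, List.map_cons,
    List.map_nil]
  rfl

lemma crownSites_nodup (m : ℕ) : ((crownSites m).map RecouplingSite.i).Nodup := by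
  simp only [crownSites, List.map_append, List.map_map, List.map_cons, List.map_nil,
    Function.comp_def, site]
  simp only [List.nodup_append', List.nodup_cons, List.disjoint_left, List.mem_append,
    List.mem_map, List.mem_range, List.mem_cons, List.not_mem_nil, or_false, newEdge_inj,
    Option.some.injEq, Prod.mk.injEq, List.nodup_nil, not_false_eq_true, and_true, true_and]
  refine ⟨⟨⟨List.Nodup.map_on (fun x _ y _ h => ?_) List.nodup_range, ?_⟩,
    List.Nodup.map_on (fun x _ y _ h => ?_) List.nodup_range, ?_⟩, ?_, ?_⟩
  · simp only [newEdge_inj, Option.some.injEq, Prod.mk.injEq] at h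
    omega
  · rintro _ rfl ⟨y, hy, h⟩
    simp only [newEdge_inj, Option.some.injEq, Prod.mk.injEq] at h
    omega
  · simp only [newEdge_inj, Option.some.injEq, Prod.mk.injEq] at h
    omega
  · rintro _ (rfl | ⟨y, hy, rfl⟩) ⟨x, hx, h⟩ <;>
    · simp only [newEdge_inj, Option.some.injEq, Prod.mk.injEq] at h
      split_ifs at h <;> omega
  · omega
  · rintro _ ((rfl | ⟨y, hy, rfl⟩) | ⟨x, hx, rfl⟩) (h | h) <;>
    · simp only [newEdge_inj, Option.some.injEq, Prod.mk.injEq] at h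
      (try split_ifs at h) <;> omega

/-- The vertices at which two hexagons of the bulk meet a hexagon of the crown that will become a
triangle. -/
def sides (m : ℕ) : Net Edge :=
  ∑ y ∈ Finset.range m,
    {tri (hex (m + 1) (y + 1)) (hex (m + 2) (y + 1)) (hex (m + 1) (y + 1 + 1))} +
  ∑ x ∈ Finset.range m,
    {tri (hex (x + 1) (m + 1)) (hex (x + 1 + 1) (m + 1)) (hex (x + 1) (m + 2))}

/-- The top hexagon of `H_(m + 3)`. -/
def topTriangle (m : ℕ) : Triangle Edge where
  a := s(hex (m + 1) (m + 2), hex (m + 2) (m + 2))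
  b := s(none, hex (m + 1) (m + 2))
  c := s(hex (m + 2) (m + 1), none)
  d := s(hex (m + 2) (m + 2), hex (m + 2) (m + 1))
  e := s(hex (m + 2) (m + 2), none)
  f := s(hex (m + 1) (m + 2), hex (m + 2) (m + 1))

/-- After the bubble move at the top, the ends of the edges to be recoupled are pairwise disjoint,
and they are all the vertices of the crown but those in `sides`. -/
lemma exists_honeycomb_eq_topTriangle_add (m : ℕ) : ∃ R : Net Edge,
    honeycomb (m + 3) = (topTriangle m).before + R ∧
    Net.map Sum.inl ((topTriangle m).after + R) =
      ((crownSites m).map RecouplingSite.before).sum + Net.map Sum.inl (sides m + bulk m) := by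
  refine ⟨bulk m +
    (∑ y ∈ Finset.range (m + 1),
      {tri (hex (m + 1) y) (hex (m + 2) y) (hex (m + 1) (y + 1))} +
    ∑ x ∈ Finset.range (m + 1),
      {tri (hex x (m + 1)) (hex (x + 1) (m + 1)) (hex x (m + 2))} +
    {tri (hex (m + 1) (m + 1)) (hex (m + 2) (m + 1)) (hex (m + 1) (m + 2))}) +
    (∑ y ∈ Finset.range (m + 1), {tri (hex (m + 2) y) none (hex (m + 2) (y + 1))} +
    ∑ x ∈ Finset.range (m + 1), {tri (hex x (m + 2)) (hex (x + 1) (m + 2)) none}) +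
    (∑ y ∈ Finset.range (m + 1),
      {tri (hex (m + 2) (y + 1)) (hex (m + 1) (y + 1)) (hex (m + 2) y)} +
    {tri (hex (m + 2) 0) (hex (m + 1) 0) none} +
    ∑ x ∈ Finset.range (m + 1),
      {tri (hex (x + 1) (m + 2)) (hex x (m + 2)) (hex (x + 1) (m + 1))} +
    {tri (hex 0 (m + 2)) none (hex 0 (m + 1))}), ?_, ?_⟩
  · have e : (topTriangle m).before =
        {tri (hex (m + 2) (m + 1)) none (hex (m + 2) (m + 2))} +
        {tri (hex (m + 1) (m + 2)) (hex (m + 2) (m + 2)) none} +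
        {tri (hex (m + 2) (m + 2)) (hex (m + 1) (m + 2)) (hex (m + 2) (m + 1))} := by
      rw [tri_rotate (hex (m + 1) (m + 2)), tri_rotate (hex (m + 2) (m + 2)) none,
        tri_rotate (hex (m + 2) (m + 2)) (hex (m + 1) (m + 2)) (hex (m + 2) (m + 1))]
      simp only [Triangle.before, topTriangle, tri,
        Sym2.eq_swap (a := none) (b := hex (m + 2) (m + 2)),
        Sym2.eq_swap (a := hex (m + 2) (m + 1)) (b := hex (m + 2) (m + 2)),
        Sym2.eq_swap (a := hex (m + 2) (m + 2)) (b := hex (m + 1) (m + 2))]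
      abel
    rw [honeycomb_eq_bulk_add_crown, e, Finset.sum_range_succ _ (m + 1),
      Finset.sum_range_succ _ (m + 1)]
    push_cast
    simp only [show ((m : ℤ) + 1 + 1) = m + 2 by ring]
    abel
  · have e : (topTriangle m).after =
        {tri (hex (m + 1) (m + 2)) (hex (m + 2) (m + 1)) none} := by
      rw [tri_rotate, tri_rotate]
      rfl
    have r1 : ∀ y : ℕ, tri (hex (m + 2) y) none (hex (m + 2) (y + 1)) =
        tri (hex (m + 2) (y + 1)) (hex (m + 2) y) none := fun y => by
      rw [tri_rotate (hex (m + 2) (y + 1))]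
    have r2 : ∀ y : ℕ, tri (hex (m + 2) (y + 1)) (hex (m + 1) (y + 1)) (hex (m + 2) y) =
        tri (hex (m + 2) y) (hex (m + 2) (y + 1)) (hex (m + 1) (y + 1)) := fun y => by
      rw [tri_rotate (hex (m + 2) y)]
    have r3 : tri (hex (m + 1) (m + 1)) (hex (m + 2) (m + 1)) (hex (m + 1) (m + 2)) =
        tri (hex (m + 2) (m + 1)) (hex (m + 1) (m + 2)) (hex (m + 1) (m + 1)) := by
      rw [tri_rotate]
    have r5 : tri (hex 0 (m + 1)) (hex 1 (m + 1)) (hex 0 (m + 2)) =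
        tri (hex 0 (m + 2)) (hex 0 (m + 1)) (hex 1 (m + 1)) := by
      rw [tri_rotate (hex 0 (m + 2))]
    have r6 : tri (hex 0 (m + 2)) none (hex 0 (m + 1)) =
        tri (hex 0 (m + 1)) (hex 0 (m + 2)) none := by
      rw [tri_rotate (hex 0 (m + 1))]
    simp only [crownSites, List.map_append, List.map_map, List.map_cons, List.map_nil,
      List.sum_append, List.sum_cons, List.sum_nil, Function.comp_def, site_before,
      sum_map_range, ← Net.map_sum, ← Net.map_add, add_zero]
    congr 1
    rw [e, sides]
    simp only [r1, r2, r3, Finset.sum_add_distrib]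
    rw [Finset.sum_range_succ' (fun y : ℕ => ({tri (hex (m + 1) y) (hex (m + 2) y)
        (hex (m + 1) (y + 1))} : Net Edge)),
      Finset.sum_range_succ' (fun x : ℕ => ({tri (hex x (m + 1)) (hex (x + 1) (m + 1))
        (hex x (m + 2))} : Net Edge))]
    push_cast
    simp only [r5, r6]
    abel

/-! ### Removal of the bubbles -/

/-- The outer vertices, after recoupling, of a hexagon of the crown at the right that becomes a
triangle. -/
def rightPart (m y : ℕ) : Net Label :=
  {vert (newEdge (hex (m + 1) (y + 1 + 1)))
    (oldEdge (hex (m + 1) (y + 1 + 1)) (hex (m + 2) (y + 1)))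
    (oldEdge (hex (m + 2) (y + 1)) none)} +
  {vert (newEdge (hex (m + 1) (y + 1)))
    (oldEdge none (hex (m + 2) (y + 1)))
    (oldEdge (hex (m + 2) (y + 1)) (hex (m + 1) (y + 1)))}

/-- The outer vertices, after recoupling, of a hexagon of the crown at the left that becomes a
triangle. -/
def leftPart (m x : ℕ) : Net Label :=
  {vert (newEdge (hex (x + 1 + 1) (if x + 1 = m then m + 2 else m + 1)))
    (oldEdge none (hex (x + 1) (m + 2)))
    (oldEdge (hex (x + 1) (m + 2)) (hex (x + 1 + 1) (m + 1)))} +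
  {vert (newEdge (hex (x + 1) (m + 1)))
    (oldEdge (hex (x + 1) (m + 1)) (hex (x + 1) (m + 2)))
    (oldEdge (hex (x + 1) (m + 2)) none)}

/-- The vertices that do not belong to one of the four bubbles created by recoupling. -/
def besideBubbles (m : ℕ) : Net Label :=
  ∑ y ∈ Finset.range m, rightPart m y + ∑ x ∈ Finset.range m, leftPart m x +
  {vert (newEdge (hex (m + 2) 0)) (oldEdge (hex (m + 1) 1) (hex (m + 1) 0))
    (oldEdge (hex (m + 1) 0) none)} +
  {vert (newEdge (hex 0 (m + 2))) (oldEdge none (hex 0 (m + 1)))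
    (oldEdge (hex 0 (m + 1)) (hex 1 (m + 1)))} +
  Net.map Sum.inl (sides m + bulk m)

/-- The four bubbles are the two lateral hexagons and the two crown neighbours of the top
hexagon. -/
lemma crownSites_after (m : ℕ) :
    ((crownSites m).map RecouplingSite.after).sum + Net.map Sum.inl (sides m + bulk m) =
    {vert (newEdge (hex (m + 1) 1)) (oldEdge (hex (m + 1) 1) (hex (m + 2) 0))
        (oldEdge (hex (m + 2) 0) none)} +
      {vert (newEdge (hex (m + 2) 0)) (oldEdge (hex (m + 2) 0) none)
        (oldEdge (hex (m + 1) 1) (hex (m + 2) 0))} +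
    ({vert (newEdge (hex 1 (if 0 = m then m + 2 else m + 1))) (oldEdge none (hex 0 (m + 2)))
        (oldEdge (hex 0 (m + 2)) (hex 1 (m + 1)))} +
      {vert (newEdge (hex 0 (m + 2))) (oldEdge (hex 0 (m + 2)) (hex 1 (m + 1)))
        (oldEdge none (hex 0 (m + 2)))} +
    ({vert (newEdge (hex (m + 1) (m + 1))) (oldEdge none (hex (m + 2) (m + 1)))
        (oldEdge (hex (m + 2) (m + 1)) (hex (m + 1) (m + 1)))} +
      {vert (newEdge (hex (m + 2) (m + 2)))
        (oldEdge (hex (m + 2) (m + 1)) (hex (m + 1) (m + 1)))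
        (oldEdge none (hex (m + 2) (m + 1)))} +
    ({vert (newEdge (hex (m + 2) (m + 2))) (oldEdge none (hex (m + 1) (m + 2)))
        (oldEdge (hex (m + 1) (m + 2)) (hex (m + 1) (m + 1)))} +
      {vert (newEdge (hex (m + 1) (m + 2)))
        (oldEdge (hex (m + 1) (m + 2)) (hex (m + 1) (m + 1)))
        (oldEdge none (hex (m + 1) (m + 2)))} +
    besideBubbles m))) := by
  simp only [crownSites, List.map_append, List.map_map, List.map_cons, List.map_nil,
    List.sum_append, List.sum_cons, List.sum_nil, Function.comp_def, site_after,
    sum_map_range, add_zero, besideBubbles, rightPart, leftPart,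
    Finset.sum_add_distrib]
  rw [Finset.sum_range_succ' (fun y : ℕ => ({vert (newEdge (hex (m + 1) (y + 1)))
      (oldEdge (hex (m + 1) (y + 1)) (hex (m + 2) y)) (oldEdge (hex (m + 2) y) none)} : Net Label)),
    Finset.sum_range_succ (fun y : ℕ => ({vert (newEdge (hex (m + 1) (y + 1)))
      (oldEdge none (hex (m + 2) (y + 1)))
      (oldEdge (hex (m + 2) (y + 1)) (hex (m + 1) (y + 1)))} : Net Label)),
    Finset.sum_range_succ' (fun x : ℕ => ({vert (newEdge (hex (x + 1)
      (if x = m then m + 2 else m + 1))) (oldEdge none (hex x (m + 2)))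
      (oldEdge (hex x (m + 2)) (hex (x + 1) (m + 1)))} : Net Label)),
    Finset.sum_range_succ (fun x : ℕ => ({vert (newEdge (hex (x + 1)
      (if x = m then m + 2 else m + 1))) (oldEdge (hex (x + 1) (m + 1)) (hex (x + 1) (m + 2)))
      (oldEdge (hex (x + 1) (m + 2)) none)} : Net Label))]
  have e : ∑ x ∈ Finset.range m, ({vert (newEdge (hex (x + 1)
      (if x = m then m + 2 else m + 1))) (oldEdge (hex (x + 1) (m + 1)) (hex (x + 1) (m + 2)))
      (oldEdge (hex (x + 1) (m + 2)) none)} : Net Label) =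
      ∑ x ∈ Finset.range m, {vert (newEdge (hex (x + 1) (m + 1)))
        (oldEdge (hex (x + 1) (m + 1)) (hex (x + 1) (m + 2)))
        (oldEdge (hex (x + 1) (m + 2)) none)} := by
    refine Finset.sum_congr rfl fun x hx => ?_
    rw [if_neg (Finset.mem_range.mp hx).ne]
  push_cast
  simp only [if_true]
  rw [e, oldEdge_comm none (hex (m + 1) (m + 2)),
    oldEdge_comm (hex (m + 1) (m + 2)) (hex (m + 1) (m + 1)),
    oldEdge_comm (hex (m + 2) (m + 1)) (hex (m + 1) (m + 1)),
    oldEdge_comm none (hex (m + 2) (m + 1)),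
    oldEdge_comm none (hex (m + 2) 0), oldEdge_comm (hex (m + 2) 0) (hex (m + 1) 1),
    oldEdge_comm none (hex 0 (m + 2)), oldEdge_comm (hex 0 (m + 2)) (hex 1 (m + 1))]
  abel

/-- The hexagons of `H_(m + 2)` whose sides towards the outer region are new edges. -/
def Border (m : ℕ) (c : Cell) : Prop :=
  (c.1 = m + 1 ∧ 1 ≤ c.2 ∧ c.2 ≤ m + 1) ∨ (c.2 = m + 1 ∧ 1 ≤ c.1 ∧ c.1 ≤ m + 1)

lemma border_right {m : ℕ} {y : ℤ} (h : 1 ≤ y ∧ y ≤ m + 1) : Border m (m + 1, y) :=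
  Or.inl ⟨rfl, h⟩

lemma border_left {m : ℕ} {x : ℤ} (h : 1 ≤ x ∧ x ≤ m + 1) : Border m (x, m + 1) :=
  Or.inr ⟨rfl, h⟩

open Classical in
/-- The edges of the network after the Schur lemma: those between the outer region and the hexagons
on the border are new, the others are old. -/
noncomputable def labelling (m : ℕ) (e : Edge) : Label :=
  if ∃ c, Border m c ∧ e = outer c then Sum.inr e else Sum.inl e

lemma labelling_injective (m : ℕ) : Function.Injective (labelling m) := by
  intro e f h
  unfold labelling at h
  split_ifs at h <;> simpa using h

lemma labelling_inner (m : ℕ) (c d : Cell) :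
    labelling m s(some c, some d) = oldEdge (some c) (some d) := by
  refine if_neg ?_
  rintro ⟨u, -, h⟩
  simp [outer] at h

lemma labelling_outer_of_border {m : ℕ} {c : Cell} (h : Border m c) :
    labelling m s(some c, none) = newEdge (some c) := if_pos ⟨c, h, rfl⟩

lemma labelling_outer_of_not_border {m : ℕ} {c : Cell} (h : ¬ Border m c) :
    labelling m s(some c, none) = oldEdge (some c) none := by
  refine if_neg ?_
  rintro ⟨u, hu, e⟩
  simp only [outer, Sym2.congr_left, Option.some.injEq] at e
  exact h (e ▸ hu)

lemma Net.map_congr {α β : Type} {f g : α → β} {N : Net α}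
    (h : ∀ v ∈ N, ∀ e ∈ v, f e = g e) : Net.map f N = Net.map g N := by
  refine Multiset.map_congr rfl fun v hv => ?_
  have hv := h v hv
  induction v using Quotient.inductionOn with
  | _ l => exact congrArg _ (List.map_congr_left fun e he => hv e he)

lemma mem_bulk {m : ℕ} {v : Cycle Edge} (hv : v ∈ bulk m) :
    (∃ x y : ℕ, x < m + 1 ∧ y < m + 1 ∧ v = tri (hex x y) (hex (x + 1) y) (hex x (y + 1))) ∨
    (∃ x y : ℕ, x < m + 1 ∧ y < m + 1 ∧
      v = tri (hex (x + 1) (y + 1)) (hex x (y + 1)) (hex (x + 1) y)) ∨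
    (∃ x : ℕ, x < m + 1 ∧ v = tri (hex (x + 1) 0) (hex x 0) none) ∨
    (∃ y : ℕ, y < m + 1 ∧ v = tri (hex 0 (y + 1)) none (hex 0 y)) := by
  simp only [bulk, Multiset.mem_add, Multiset.mem_sum, Finset.mem_range,
    Multiset.mem_singleton] at hv
  rcases hv with ⟨x, hx, y, hy, rfl⟩ | ⟨⟨x, y⟩, hxy, rfl⟩
  · exact Or.inl ⟨x, y, hx, hy, rfl⟩
  · simp only [Finset.mem_erase, Finset.mem_product, Finset.mem_range, ne_eq,
      Prod.mk.injEq] at hxy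
    right
    unfold bottomVertex
    rcases x with _ | x <;> rcases y with _ | y
    · omega
    · right; right
      refine ⟨y, by omega, ?_⟩
      rw [clip_of_mem (by omega), clip_of_notMem (by omega), clip_of_mem (by omega)]
      congr 4; push_cast; ring
    · right; left
      refine ⟨x, by omega, ?_⟩
      rw [clip_of_mem (by omega), clip_of_mem (by omega), clip_of_notMem (by omega)]
      congr 4; push_cast; ring
    · left
      refine ⟨x, y, by omega, by omega, ?_⟩
      rw [clip_of_mem (by omega), clip_of_mem (by omega), clip_of_mem (by omega)]
      congr 4 <;> (push_cast; ring)

lemma map_labelling_bulk (m : ℕ) : Net.map (labelling m) (bulk m) = Net.map Sum.inl (bulk m) := by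
  refine Net.map_congr fun v hv e he => ?_
  rcases mem_bulk hv with ⟨x, y, hx, hy, rfl⟩ | ⟨x, y, hx, hy, rfl⟩ | ⟨x, hx, rfl⟩ | ⟨y, hy, rfl⟩ <;>
    rcases mem_vert.mp he with rfl | rfl | rfl
  all_goals first
    | exact labelling_inner _ _ _
    | exact labelling_outer_of_not_border (by simp only [Border]; omega)
    | (rw [Sym2.eq_swap]; exact labelling_outer_of_not_border (by simp only [Border]; omega))

/-- A triangular crown hexagon `t` next to the hexagons `q` and `p` of the bulk. -/
def crownTriangle (p q t : Face) : Triangle Edge where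
  a := s(p, t)
  b := s(p, none)
  c := s(q, none)
  d := s(t, q)
  e := s(t, none)
  f := s(p, q)

lemma crownTriangle_before (p q t : Face) :
    (crownTriangle p q t).before = {tri none p t} + {tri q none t} + {tri p q t} := by
  simp only [Triangle.before, crownTriangle, tri]
  rw [Sym2.eq_swap (a := none) (b := p), Sym2.eq_swap (a := none) (b := t),
    Sym2.eq_swap (a := t) (b := p), Sym2.eq_swap (a := q) (b := t)]

lemma crownTriangle_after (p q t : Face) :
    (crownTriangle p q t).after = {tri p q none} := by
  rw [tri_rotate, tri_rotate]
  simp only [Triangle.after, crownTriangle, tri]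
  rw [Sym2.eq_swap (a := none) (b := p)]

/-- The hexagons of the crown at the right which become triangles. -/
def rightTriangle (m y : ℕ) : Triangle Edge :=
  crownTriangle (hex (m + 1) (y + 1 + 1)) (hex (m + 1) (y + 1)) (hex (m + 2) (y + 1))

/-- The hexagons of the crown at the left which become triangles. -/
def leftTriangle (m x : ℕ) : Triangle Edge :=
  crownTriangle (hex (x + 1) (m + 1)) (hex (x + 1 + 1) (m + 1)) (hex (x + 1) (m + 2))

/-- The triangles left by the Schur lemma, in the order of `bubbleEdges`. -/
def triangles (m : ℕ) : List (Triangle Edge) :=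
  (List.range m).map (rightTriangle m) ++ (List.range m).map (leftTriangle m)

/-- What the bubble moves leave unchanged. -/
def remainder (m : ℕ) : Net Edge :=
  {tri (hex (m + 1) 0) none (hex (m + 1) 1)} + {tri (hex 0 (m + 1)) (hex 1 (m + 1)) none} + bulk m

/-- The composition of the four renamings performed by the Schur lemma. -/
def renameAll (m : ℕ) (z : Label) : Label :=
  rename (newEdge (hex (m + 1) (m + 1))) (newEdge (hex (m + 1) (m + 2)))
    (rename (newEdge (hex (m + 1) (m + 1))) (newEdge (hex (m + 2) (m + 2)))
      (rename (newEdge (hex 1 (if 0 = m then m + 2 else m + 1))) (newEdge (hex 0 (m + 2)))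
        (rename (newEdge (hex (m + 1) 1)) (newEdge (hex (m + 2) 0)) z)))

lemma renameAll_oldEdge (m : ℕ) (f g : Face) : renameAll m (oldEdge f g) = oldEdge f g := by
  simp [renameAll, rename, oldEdge_ne_newEdge]

lemma rename_self {α : Type} [DecidableEq α] (p q : α) : rename p q q = p := if_pos rfl

lemma rename_of_ne {α : Type} [DecidableEq α] (p : α) {q z : α} (h : z ≠ q) :
    rename p q z = z := if_neg h

lemma newEdge_hex_ne {x y x' y' : ℤ} (h : x ≠ x' ∨ y ≠ y') :
    newEdge (hex x y) ≠ newEdge (hex x' y') := by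
  simp only [newEdge_inj, ne_eq, Option.some.injEq, Prod.mk.injEq]
  omega

lemma renameAll_border (m : ℕ) {c : Cell} (h : Border m c) :
    renameAll m (newEdge (some c)) = newEdge (some c) := by
  obtain ⟨x, y⟩ := c
  simp only [Border] at h
  unfold renameAll
  rw [rename_of_ne _ (newEdge_hex_ne (by omega)), rename_of_ne _ (newEdge_hex_ne (by omega)),
    rename_of_ne _ (newEdge_hex_ne (by omega)), rename_of_ne _ (newEdge_hex_ne (by omega))]

lemma renameAll_left (m x : ℕ) (hx : x ≤ m) :
    renameAll m (newEdge (hex (x + 1) (if x = m then m + 2 else m + 1))) =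
      newEdge (hex (x + 1) (m + 1)) := by
  split_ifs with h
  · subst h
    unfold renameAll
    rw [rename_of_ne _ (newEdge_hex_ne (by omega)), rename_of_ne _ (newEdge_hex_ne (by omega)),
      rename_of_ne _ (newEdge_hex_ne (by omega)), rename_self]
  · exact renameAll_border m (border_left (by omega))

lemma renameAll_right_lateral (m : ℕ) :
    renameAll m (newEdge (hex (m + 2) 0)) = newEdge (hex (m + 1) 1) := by
  rw [← renameAll_border m (c := (m + 1, 1)) (border_right (by omega))]
  unfold renameAll
  rw [rename_self, rename_of_ne _ (newEdge_hex_ne (y := 1) (y' := 0) (by omega))]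

lemma renameAll_left_lateral (m : ℕ) :
    renameAll m (newEdge (hex 0 (m + 2))) = newEdge (hex 1 (m + 1)) := by
  have h := renameAll_left m 0 (by omega)
  push_cast at h
  rw [← h]
  unfold renameAll
  rw [rename_of_ne _ (newEdge_hex_ne (x := 0) (by omega)), rename_self,
    rename_of_ne (newEdge (hex (m + 1) 1)) (newEdge_hex_ne (by split_ifs <;> omega)),
    rename_of_ne (newEdge (hex 1 _)) (newEdge_hex_ne (by omega))]

lemma renameAll_inl (m : ℕ) (e : Edge) : renameAll m (Sum.inl e) = Sum.inl e := by
  induction e using Sym2.inductionOn with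
  | _ f g => exact renameAll_oldEdge m f g

lemma map_renameAll_inl (m : ℕ) (N : Net Edge) :
    Net.map (renameAll m) (Net.map Sum.inl N) = Net.map Sum.inl N := by
  rw [Net.map_map]
  exact Net.map_congr fun _ _ e _ => renameAll_inl m e

lemma map_renameAll_rightPart {m y : ℕ} (hy : y < m) :
    Net.map (renameAll m) (rightPart m y) + Net.map Sum.inl
      {tri (hex (m + 1) (y + 1)) (hex (m + 2) (y + 1)) (hex (m + 1) (y + 1 + 1))} =
    Net.map (labelling m) (rightTriangle m y).before := by
  rw [← tri_rotate (hex (m + 1) (y + 1 + 1))]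
  simp only [rightPart, Triangle.before, rightTriangle, crownTriangle, Net.map_add,
    Net.map_singleton, tri]
  rw [labelling_inner, labelling_inner, labelling_inner,
    labelling_outer_of_border (border_right (by omega)),
    labelling_outer_of_border (border_right (by omega)),
    labelling_outer_of_not_border (by simp only [Border]; omega),
    renameAll_border _ (border_right (by omega)), renameAll_border _ (border_right (by omega)),
    renameAll_oldEdge, renameAll_oldEdge, renameAll_oldEdge, renameAll_oldEdge,
    oldEdge_comm none, Sym2.eq_swap (a := hex (m + 1) (y + 1)) (b := hex (m + 2) (y + 1)),
    Sym2.eq_swap (a := hex (m + 2) (y + 1)) (b := hex (m + 1) (y + 1 + 1))]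
  rfl

lemma map_renameAll_leftPart {m x : ℕ} (hx : x < m) :
    Net.map (renameAll m) (leftPart m x) + Net.map Sum.inl
      {tri (hex (x + 1) (m + 1)) (hex (x + 1 + 1) (m + 1)) (hex (x + 1) (m + 2))} =
    Net.map (labelling m) (leftTriangle m x).before := by
  have h := renameAll_left m (x + 1) hx
  push_cast at h
  simp only [leftPart, Triangle.before, leftTriangle, crownTriangle, Net.map_add,
    Net.map_singleton, tri]
  rw [labelling_inner, labelling_inner, labelling_inner,
    labelling_outer_of_border (border_left (by omega)),
    labelling_outer_of_border (border_left (by omega)),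
    labelling_outer_of_not_border (by simp only [Border]; omega), h,
    renameAll_border _ (border_left (by omega)),
    renameAll_oldEdge, renameAll_oldEdge, renameAll_oldEdge, renameAll_oldEdge,
    oldEdge_comm none, Sym2.eq_swap (a := hex (x + 1 + 1) (m + 1)) (b := hex (x + 1) (m + 2)),
    Sym2.eq_swap (a := hex (x + 1) (m + 2)) (b := hex (x + 1) (m + 1))]
  exact congrArg (· + _) (add_comm _ _)

/-- The Schur lemma leaves a network in which the triangles can be removed by bubble moves. -/
lemma map_renameAll_besideBubbles (m : ℕ) : Net.map (renameAll m) (besideBubbles m) =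
    Net.map (labelling m) (((triangles m).map Triangle.before).sum + remainder m) := by
  have hright : ∑ y ∈ Finset.range m, Net.map (labelling m) (rightTriangle m y).before =
      ∑ y ∈ Finset.range m, Net.map (renameAll m) (rightPart m y) +
      ∑ y ∈ Finset.range m, Net.map Sum.inl
        {tri (hex (m + 1) (y + 1)) (hex (m + 2) (y + 1)) (hex (m + 1) (y + 1 + 1))} := by
    rw [← Finset.sum_add_distrib]
    exact Finset.sum_congr rfl fun y hy =>
      (map_renameAll_rightPart (Finset.mem_range.mp hy)).symm
  have hleft : ∑ x ∈ Finset.range m, Net.map (labelling m) (leftTriangle m x).before =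
      ∑ x ∈ Finset.range m, Net.map (renameAll m) (leftPart m x) +
      ∑ x ∈ Finset.range m, Net.map Sum.inl
        {tri (hex (x + 1) (m + 1)) (hex (x + 1 + 1) (m + 1)) (hex (x + 1) (m + 2))} := by
    rw [← Finset.sum_add_distrib]
    exact Finset.sum_congr rfl fun x hx =>
      (map_renameAll_leftPart (Finset.mem_range.mp hx)).symm
  have h1 : Net.map (labelling m) {tri (hex (m + 1) 0) none (hex (m + 1) 1)} =
      Net.map (renameAll m) {vert (newEdge (hex (m + 2) 0))
        (oldEdge (hex (m + 1) 1) (hex (m + 1) 0)) (oldEdge (hex (m + 1) 0) none)} := by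
    rw [tri_rotate, tri, Net.map_singleton, Net.map_singleton, labelling_inner,
      Sym2.eq_swap (a := none), labelling_outer_of_border (border_right (by omega)),
      labelling_outer_of_not_border (by simp only [Border]; omega), renameAll_right_lateral,
      renameAll_oldEdge, renameAll_oldEdge]
  have h2 : Net.map (labelling m) {tri (hex 0 (m + 1)) (hex 1 (m + 1)) none} =
      Net.map (renameAll m) {vert (newEdge (hex 0 (m + 2))) (oldEdge none (hex 0 (m + 1)))
        (oldEdge (hex 0 (m + 1)) (hex 1 (m + 1)))} := by
    rw [tri_rotate, tri, Net.map_singleton, Net.map_singleton, labelling_inner,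
      labelling_outer_of_border (border_left (by omega)), Sym2.eq_swap (a := none),
      labelling_outer_of_not_border (by simp only [Border]; omega), renameAll_left_lateral,
      renameAll_oldEdge, renameAll_oldEdge, oldEdge_comm none]
  simp only [besideBubbles, triangles, remainder, sides, List.map_append, List.map_map,
    List.sum_append, Function.comp_def, sum_map_range, Net.map_add, Net.map_sum,
    map_renameAll_inl, map_labelling_bulk, hright, hleft, h1, h2]
  abel

/-- The bubble moves turn the network into `H_(m + 2)`. -/
lemma triangles_after (m : ℕ) :
    ((triangles m).map Triangle.after).sum + remainder m = honeycomb (m + 2) := by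
  have hright : ∀ y : ℕ, (rightTriangle m y).after =
      {tri (hex (m + 1) (y + 1)) none (hex (m + 1) (y + 1 + 1))} := fun y => by
    rw [rightTriangle, crownTriangle_after, tri_rotate]
  have hleft : ∀ x : ℕ, (leftTriangle m x).after =
      {tri (hex (x + 1) (m + 1)) (hex (x + 1 + 1) (m + 1)) none} := fun x =>
    crownTriangle_after _ _ _
  rw [honeycomb_eq_bulk_add,
    Finset.sum_range_succ' (fun y : ℕ => ({tri (hex (m + 1) y) none (hex (m + 1) (y + 1))} :
      Net Edge)),
    Finset.sum_range_succ' (fun x : ℕ => ({tri (hex x (m + 1)) (hex (x + 1) (m + 1)) none} :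
      Net Edge))]
  simp only [triangles, remainder, List.map_append, List.map_map,
    List.sum_append, Function.comp_def, sum_map_range, hright, hleft]
  push_cast
  abel

/-! ### Absence of further bubbles -/

/-- The hexagons `c` and `d` meet the outer region, in the counterclockwise order `none, c, d`, at a
vertex of the network left by the Schur lemma.  (Only the consequences that exclude the same relation
with `c` and `d` exchanged are recorded.) -/
def OuterPair (m : ℕ) (c d : Cell) : Prop :=
  (d.1 = c.1 + 1 ∧ d.2 = c.2 - 1) ∨ (d.1 = c.1 - 1 ∧ d.2 = c.2 ∧ c.2 < m + 1) ∨
  (d.1 = c.1 + 1 ∧ d.2 = c.2 ∧ c.2 = m + 1) ∨ (d.1 = c.1 ∧ d.2 = c.2 + 1 ∧ c.1 < m + 1) ∨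
  (d.1 = c.1 ∧ d.2 = c.2 - 1 ∧ c.1 = m + 1)

/-- A counterclockwise triple of faces: three hexagons whose centres form a positively oriented
triangle, or two hexagons and the outer region. -/
def Oriented (m : ℕ) : Face → Face → Face → Prop
  | some a, some b, some c => (b.1 - a.1) * (c.2 - a.2) - (b.2 - a.2) * (c.1 - a.1) = 1
  | none, some a, some b => OuterPair m a b
  | some b, none, some a => OuterPair m a b
  | some a, some b, none => OuterPair m a b
  | _, _, _ => False

lemma Oriented.rotate {m : ℕ} {f g h : Face} (H : Oriented m f g h) : Oriented m g h f := by
  rcases f with _ | f <;> rcases g with _ | g <;> rcases h with _ | h <;>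
    simp only [Oriented] at H ⊢ <;> first | exact H | linarith

lemma Oriented.not_swap {m : ℕ} {f g h : Face} (H : Oriented m f g h) : ¬ Oriented m g f h := by
  intro H'
  rcases f with _ | f <;> rcases g with _ | g <;> rcases h with _ | h <;>
    simp only [Oriented, OuterPair] at H H' <;> first | omega | linarith

lemma Oriented.ne {m : ℕ} {f g h : Face} (H : Oriented m f g h) : f ≠ g := by
  rintro rfl
  rcases f with _ | f <;> rcases h with _ | h <;>
    simp only [Oriented, OuterPair] at H <;> omega

/-- A bubble would be formed by two vertices with the same faces around them, in opposite orders. -/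
lemma not_hasBubble_of_oriented {m : ℕ} {col : Edge → Colour} (hcol : Function.Injective col)
    {N : Net Edge} (hN : ∀ v ∈ N, ∃ f g h, v = tri f g h ∧ Oriented m f g h) :
    ¬ HasBubble (Net.map col N) := by
  rintro ⟨p, q, x, y, R, hR⟩
  have key : ∀ p x y : Colour, vert p x y ∈ Net.map col N → ∃ f g h, Oriented m f g h ∧
      x = col s(g, h) ∧ y = col s(h, f) := by
    intro p x y hmem
    obtain ⟨v, hv, e⟩ := Multiset.mem_map.mp hmem
    obtain ⟨f, g, h, rfl, H⟩ := hN v hv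
    rw [tri, map_vert, vert_eq_vert_iff] at e
    rcases e with ⟨-, e2, e3⟩ | ⟨-, e2, e3⟩ | ⟨-, e2, e3⟩
    · exact ⟨f, g, h, H, e2.symm, e3.symm⟩
    · exact ⟨g, h, f, H.rotate, e2.symm, e3.symm⟩
    · exact ⟨h, f, g, H.rotate.rotate, e2.symm, e3.symm⟩
  obtain ⟨f, g, h, H, rfl, rfl⟩ := key p x y (by simp [hR])
  obtain ⟨f', g', h', H', e1, e2⟩ := key q (col s(h, f)) (col s(g, h)) (by simp [hR])
  have e1 := hcol e1
  have e2 := hcol e2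
  have n1 := H.ne
  have n2 := H.rotate.ne
  have n3 := H.rotate.rotate.ne
  rw [Sym2.eq_iff] at e1 e2
  rcases e1 with ⟨-, h2⟩ | ⟨h1, h2⟩
  · rcases e2 with ⟨h3, -⟩ | ⟨-, h4⟩
    · exact n1 (h2.trans h3.symm)
    · exact n3 (h4.trans h2.symm)
  · rcases e2 with ⟨h3, -⟩ | ⟨h3, -⟩
    · exact n2 (h3.trans h1.symm)
    · subst h1 h2 h3
      exact H.not_swap H'

lemma oriented_of_mem (m : ℕ) (v : Cycle Edge)
    (hv : v ∈ ((triangles m).map Triangle.before).sum + remainder m) :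
    ∃ f g h, v = tri f g h ∧ Oriented m f g h := by
  simp only [triangles, remainder, List.map_append, List.map_map, List.sum_append,
    Function.comp_def, sum_map_range, rightTriangle, leftTriangle, crownTriangle_before,
    Multiset.mem_add, Multiset.mem_sum, Multiset.mem_singleton, Finset.mem_range] at hv
  rcases hv with (⟨y, hy, (rfl | rfl) | rfl⟩ | ⟨x, hx, (rfl | rfl) | rfl⟩) | (rfl | rfl) | hv
  on_goal 9 =>
    rcases mem_bulk hv with ⟨x, y, hx, hy, rfl⟩ | ⟨x, y, hx, hy, rfl⟩ | ⟨x, hx, rfl⟩ |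
      ⟨y, hy, rfl⟩
  all_goals
    refine ⟨_, _, _, rfl, ?_⟩
    first
      | (simp only [Oriented]; ring_nf; done)
      | (simp only [Oriented, OuterPair, true_and, and_true]; omega)

/-! ### A passage through the loop -/

/-- The colours which are neither used in `X` nor given to an edge by `col`. -/
def freeColours (X : Expr) (col : Edge → Colour) : Set Colour :=
  {i | X.Fresh i ∧ i ∉ Set.range col}

lemma finite_border (m : ℕ) : {c : Cell | Border m c}.Finite := by
  refine (Set.finite_Icc ((0, 0) : Cell) ((m : ℤ) + 1, (m : ℤ) + 1)).subset ?_
  rintro ⟨x, y⟩ h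
  simp only [Border, Set.mem_ofPred_eq, Set.mem_Icc, Prod.mk_le_mk] at h ⊢
  omega

lemma rename_newEdge_oldEdge (p q f g : Face) :
    rename (newEdge p) (newEdge q) (oldEdge f g) = oldEdge f g :=
  rename_of_ne _ (oldEdge_ne_newEdge _ _ _)

lemma mem_crownSites (m : ℕ) {f : Face} (hf : f = hex (m + 2) (m + 2) ∨ f = hex (m + 2) 0 ∨
    f = hex 0 (m + 2) ∨ f = hex (m + 1) (m + 2)) : ∃ t ∈ crownSites m, t.i = newEdge f := by
  rw [← List.mem_map (f := RecouplingSite.i)]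
  simp only [crownSites, List.map_append, List.map_map, List.map_cons, List.map_nil,
    Function.comp_def, site, List.mem_append, List.mem_map, List.mem_range, List.mem_cons,
    List.not_mem_nil, or_false]
  rcases hf with rfl | rfl | rfl | rfl
  · simp
  · simp
  · simp
  · exact Or.inl (Or.inr ⟨m, by omega, by simp⟩)

/-- The four applications of the Schur lemma after recoupling. -/
lemma exists_bursts {m : ℕ} {ρ : Label → Colour} (hρ : Function.Injective ρ) {X : Expr}
    (hX : X.net = Net.map ρ
      (((crownSites m).map RecouplingSite.after).sum + Net.map Sum.inl (sides m + bulk m)))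
    (hS : ∀ t ∈ crownSites m, ρ t.i ∈ X.sums) :
    ∃ Y : Expr, Relation.ReflTransGen Burst X Y ∧
      Y.net = Net.map ρ (Net.map (labelling m)
        (((triangles m).map Triangle.before).sum + remainder m)) ∧
      ∀ k, X.Fresh k → Y.Fresh k := by
  have hS' : ∀ f : Face, (f = hex (m + 2) (m + 2) ∨ f = hex (m + 2) 0 ∨
      f = hex 0 (m + 2) ∨ f = hex (m + 1) (m + 2)) → ρ (newEdge f) ∈ X.sums := by
    intro f hf
    obtain ⟨t, ht, e⟩ := mem_crownSites m hf
    exact e ▸ hS t ht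
  -- `newEdge_hex_ne` checks which of the edges in the other bubbles a burst leaves alone
  rw [crownSites_after] at hX
  obtain ⟨X₁, hb₁, hX₁, hS₁, hf₁⟩ := exists_burst hρ hX (newEdge_hex_ne (by omega))
    (hS' _ (by simp))
  simp only [Net.map_add, Net.map_singleton, rename_newEdge_oldEdge] at hX₁
  rw [rename_of_ne _ (newEdge_hex_ne (by omega)),
    rename_of_ne _ (newEdge_hex_ne (by omega)), rename_of_ne _ (newEdge_hex_ne (by omega)),
    rename_of_ne _ (newEdge_hex_ne (by omega)), rename_of_ne _ (newEdge_hex_ne (by omega))] at hX₁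
  simp only [← Net.map_singleton ρ, ← Net.map_add] at hX₁
  obtain ⟨X₂, hb₂, hX₂, hS₂, hf₂⟩ := exists_burst hρ hX₁ (newEdge_hex_ne (by omega))
    (by
      rw [hS₁]
      exact Finset.mem_erase.mpr ⟨hρ.ne (newEdge_hex_ne (by omega)), hS' _ (by simp)⟩)
  simp only [Net.map_add, Net.map_singleton, rename_newEdge_oldEdge] at hX₂
  rw [rename_of_ne _ (newEdge_hex_ne (by omega)),
    rename_of_ne _ (newEdge_hex_ne (by omega)), rename_of_ne _ (newEdge_hex_ne (by omega))] at hX₂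
  simp only [← Net.map_singleton ρ, ← Net.map_add] at hX₂
  obtain ⟨X₃, hb₃, hX₃, hS₃, hf₃⟩ := exists_burst hρ hX₂ (newEdge_hex_ne (by omega))
    (by
      rw [hS₂, hS₁]
      exact Finset.mem_erase.mpr ⟨hρ.ne (newEdge_hex_ne (by omega)),
        Finset.mem_erase.mpr ⟨hρ.ne (newEdge_hex_ne (by omega)), hS' _ (by simp)⟩⟩)
  simp only [Net.map_add, Net.map_singleton, rename_newEdge_oldEdge, rename_self] at hX₃
  rw [rename_of_ne _ (newEdge_hex_ne (by omega))] at hX₃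
  simp only [← Net.map_singleton ρ, ← Net.map_add] at hX₃
  obtain ⟨X₄, hb₄, hX₄, hS₄, hf₄⟩ := exists_burst hρ hX₃ (newEdge_hex_ne (by omega))
    (by
      rw [hS₃, hS₂, hS₁]
      exact Finset.mem_erase.mpr ⟨hρ.ne (newEdge_hex_ne (by omega)),
        Finset.mem_erase.mpr ⟨hρ.ne (newEdge_hex_ne (by omega)),
          Finset.mem_erase.mpr ⟨hρ.ne (newEdge_hex_ne (by omega)), hS' _ (by simp)⟩⟩⟩)
  refine ⟨X₄, (((Relation.ReflTransGen.single hb₁).tail hb₂).tail hb₃).tail hb₄, ?_,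
    fun k hk => hf₄ k (hf₃ k (hf₂ k (hf₁ k hk)))⟩
  rw [hX₄, ← map_renameAll_besideBubbles]
  simp only [Net.map_map]
  rfl

/-- From injectively coloured `H_(m + 3)` with infinitely many free colours, one passage leads to
`H_(m + 2)` with the same properties. -/
lemma exists_pass (m : ℕ) {col : Edge → Colour} (hcol : Function.Injective col) {X : Expr}
    (hX : X.net = (honeycomb (m + 3)).map col) (hfree : (freeColours X col).Infinite) :
    ∃ (col' : Edge → Colour) (Y : Expr), Pass (m + 3) col col' X Y ∧
      Function.Injective col' ∧ (freeColours Y col').Infinite := by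
  obtain ⟨κ, hκ, hκfree⟩ : ∃ κ : Edge → Colour, Function.Injective κ ∧
      ∀ e, κ e ∈ freeColours X col := by
    obtain ⟨g, hg⟩ := exists_injective_nat Edge
    exact ⟨fun e => hfree.natEmbedding _ (g e),
      fun a b h => hg ((hfree.natEmbedding _).injective (Subtype.ext h)),
      fun e => (hfree.natEmbedding _ (g e)).2⟩
  -- old edges keep their colours, new edges receive free ones
  set ρ : Label → Colour := Sum.elim col κ
  have hρ : Function.Injective ρ :=
    hcol.sumElim hκ fun a b h => (hκfree b).2 ⟨a, h⟩
  obtain ⟨R, hR, hR'⟩ := exists_honeycomb_eq_topTriangle_add m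
  have h1 : ((m + 3 : ℕ) : ℤ) - 1 = m + 2 := by push_cast; ring
  obtain ⟨X₁, hm₁, hX₁, hS₁, hf₁⟩ := exists_successively_bubbleMove col [topTriangle m] X R
    (by rw [hX, hR]; simp)
  have hm₁' : BubbleMove (col (topEdge (m + 3))) X X₁ := by
    rw [topEdge, h1]
    cases hm₁ with
    | cons _ _ _ _ _ h t => cases t with | nil => exact h
  have hX₁' : X₁.net = Net.map ρ (((crownSites m).map RecouplingSite.before).sum +
      Net.map Sum.inl (sides m + bulk m)) := by
    rw [hX₁, ← hR', Net.map_map]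
    simp only [List.map_cons, List.map_nil, List.sum_cons, List.sum_nil, add_zero]
    rfl
  have hnew : ∀ t ∈ crownSites m, ∃ e, ρ t.i = κ e := by
    intro t ht
    simp only [crownSites, List.mem_append, List.mem_map, List.mem_cons, List.not_mem_nil,
      or_false] at ht
    rcases ht with ((rfl | ⟨y, -, rfl⟩) | ⟨x, -, rfl⟩) | rfl | rfl <;> exact ⟨_, rfl⟩
  obtain ⟨X₂, hm₂, hX₂, hS₂, -, hf₂⟩ := exists_successively_recouple hρ (crownSites m) X₁ _ hX₁'
    (crownSites_nodup m) (fun t ht => by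
      obtain ⟨e, he⟩ := hnew t ht
      exact he ▸ hf₁ _ (hκfree e).1)
  obtain ⟨X₃, hm₃, hX₃, hf₃⟩ := exists_bursts hρ hX₂ hS₂
  have hcol' : Function.Injective fun e => ρ (labelling m e) := hρ.comp (labelling_injective m)
  rw [Net.map_map] at hX₃
  obtain ⟨Y, hm₄, hY, hS₄, hf₄⟩ := exists_successively_bubbleMove _ (triangles m) X₃ _ hX₃
  rw [triangles_after] at hY
  refine ⟨fun e => ρ (labelling m e), Y, ⟨X₁, X₂, X₃, hm₁', ?_, hm₃, ?_, ?_, hY, ?_⟩, hcol', ?_⟩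
  · have := congrArg (List.map ρ) (crownSites_edges m)
    rw [List.map_map, List.map_map] at this
    exact this ▸ hm₂
  · rw [hX₃]
    exact not_hasBubble_of_oriented hcol' (oriented_of_mem m)
  · have : (triangles m).map (fun t => ρ (labelling m t.e)) = (bubbleEdges (m + 3)).map col := by
      simp only [triangles, bubbleEdges, h1, List.map_append, List.map_map,
        Nat.add_sub_cancel, Function.comp_def, rightTriangle, leftTriangle, crownTriangle, outer]
      congr 1 <;> refine List.map_congr_left fun x _ => ?_
      all_goals
        rw [labelling_outer_of_not_border (by simp only [Border]; omega)]
        rfl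
    exact this ▸ hm₄
  · intro c d
    simp only [inner, labelling_inner]
    rfl
  · have hfin : (ρ '' {i | i ∈ (crownSites m).map RecouplingSite.i} ∪
        κ '' (outer '' {c | Border m c})).Finite :=
      ((List.finite_toSet _).image _).union (((finite_border m).image _).image _)
    -- only finitely many colours have been used up
    refine (hfree.sdiff hfin).mono ?_
    rintro k ⟨⟨hk, hkcol⟩, hkn⟩
    simp only [Set.mem_union, not_or] at hkn
    refine ⟨hf₄ k (hf₃ k (hf₂ k (hf₁ k hk) fun t ht e =>
      hkn.1 ⟨t.i, List.mem_map_of_mem ht, e.symm⟩)), ?_⟩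
    rintro ⟨e, rfl⟩
    by_cases he : ∃ c, Border m c ∧ e = outer c
    · obtain ⟨c, hc, rfl⟩ := he
      refine hkn.2 ⟨outer c, ⟨c, hc, rfl⟩, ?_⟩
      simp only [outer, labelling_outer_of_border hc]
      rfl
    · exact hkcol ⟨e, by simp only [labelling, if_neg he]; rfl⟩

/-! ### The runs of the algorithm -/

lemma honeycomb_two : honeycomb 2 =
    {tri (hex 0 0) (hex 1 0) (hex 0 1)} + {tri (hex 1 0) none (hex 1 1)} +
    {tri (hex 0 1) (hex 1 1) none} + {tri (hex 1 0) (hex 0 0) none} +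
    {tri (hex 0 1) none (hex 0 0)} + {tri (hex 1 1) (hex 0 1) (hex 1 0)} := by
  have h := honeycomb_eq_bulk_add 0
  have hs : (square 2).erase (0, 0) = {(0, 1), (1, 0), (1, 1)} := by decide
  rw [zero_add] at h
  rw [h, bulk, zero_add, hs]
  simp [bottomVertex, clip]
  simp only [← Multiset.singleton_add]
  abel

/-- The top hexagon of `H_2`, and the other three vertices arranged as in a tetrahedron. -/
lemma honeycomb_two_eq_cons : honeycomb 2 =
    vert s(none, hex 0 1) s(hex 0 1, hex 1 1) (topEdge 2) ::ₘ
    vert s(hex 1 0, none) (topEdge 2) s(hex 1 1, hex 1 0) ::ₘ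
    vert s(hex 0 1, hex 1 0) s(hex 1 1, hex 1 0) s(hex 0 1, hex 1 1) ::ₘ
    {vert s(none, hex 0 1) s(none, hex 0 0) s(hex 0 0, hex 0 1),
      vert s(hex 0 1, hex 1 0) s(hex 0 0, hex 0 1) s(hex 0 0, hex 1 0),
      vert s(hex 1 0, none) s(hex 0 0, hex 1 0) s(none, hex 0 0)} := by
  have ht : topEdge 2 = s(hex 1 1, none) := rfl
  rw [honeycomb_two, ht, tri_rotate (hex 0 0), tri_rotate (hex 0 1) (hex 1 1),
    tri_rotate (hex 1 1) none, tri_rotate (hex 1 0) (hex 0 0), tri_rotate (hex 0 0) none,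
    tri_rotate (hex 1 1)]
  simp only [tri, Sym2.eq_swap (a := none) (b := hex 1 1),
    Sym2.eq_swap (a := hex 1 0) (b := hex 1 1), Sym2.eq_swap (a := hex 1 1) (b := hex 0 1),
    Sym2.eq_swap (a := hex 1 0) (b := hex 0 1), Sym2.eq_swap (a := hex 0 1) (b := hex 0 0),
    Sym2.eq_swap (a := none) (b := hex 1 0), Sym2.eq_swap (a := hex 1 0) (b := hex 0 0),
    Sym2.eq_swap (a := hex 0 0) (b := none), Sym2.eq_swap (a := hex 0 1) (b := none),
    Multiset.insert_eq_cons, ← Multiset.singleton_add]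
  abel

lemma exists_run_two {col : Edge → Colour} {X : Expr} (hX : X.net = (honeycomb 2).map col) :
    ∃ Z : Expr, Run 2 col X Z ∧ Z.net = 0 := by
  obtain ⟨N, S, K⟩ := X
  rw [honeycomb_two_eq_cons] at hX
  simp only [Net.map, Multiset.map_cons, Multiset.insert_eq_cons, Multiset.map_singleton,
    map_vert] at hX
  subst hX
  exact ⟨_, .last _ _ _ _ (.mk _ _ _ _ _ _ _ _ _) (.mk _ _ _ _ _ _ _ _), rfl⟩

/-- The algorithm can be carried out as long as infinitely many colours are free. -/
lemma exists_run {n : ℕ} (hn : 2 ≤ n) : ∀ {col : Edge → Colour} {X : Expr},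
    Function.Injective col → X.net = (honeycomb n).map col → (freeColours X col).Infinite →
    ∃ Z : Expr, Run n col X Z ∧ Z.net = 0 := by
  induction n, hn using Nat.le_induction with
  | base => exact fun _ hX _ => exists_run_two hX
  | succ n hn ih =>
    intro col X hcol hX hfree
    obtain ⟨m, rfl⟩ := Nat.exists_eq_add_of_le' hn
    obtain ⟨col', Y, hp, hcol', hfree'⟩ := exists_pass m hcol hX hfree
    have hY := hp
    obtain ⟨-, -, -, -, -, -, -, -, hY, -⟩ := hY
    obtain ⟨Z, hZ, hZ0⟩ := ih hcol' hY hfree'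
    exact ⟨Z, .loop _ (by omega) col col' X Y Z hp hZ, hZ0⟩

lemma exists_evaluates {n : ℕ} (hn : 2 ≤ n) : ∃ S K, Evaluates n S K := by
  have hfree : (freeColours ⟨(honeycomb n).map Sum.inl, ∅, 0⟩ Sum.inl).Infinite := by
    refine (Set.infinite_range_of_injective (Sum.inr_injective (α := Edge) (β := ℕ))).mono ?_
    rintro _ ⟨k, rfl⟩
    refine ⟨⟨Finset.notMem_empty _, fun v hv hk => ?_, by simp⟩, by simp⟩
    obtain ⟨u, -, rfl⟩ := Multiset.mem_map.mp hv
    obtain ⟨e, -, he⟩ := Cycle.mem_map.mp hk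
    exact Sum.inl_ne_inr he
  obtain ⟨⟨N, S, K⟩, hZ, rfl⟩ := exists_run hn Sum.inl_injective rfl hfree
  exact ⟨S, K, hZ⟩

/-! ### The number of summations -/

lemma Successively.recouple_count {l : List Colour} {X Y : Expr}
    (h : Successively Recouple l X Y) :
    Y.net.card = X.net.card ∧ Y.sums.card = X.sums.card + l.length := by
  induction h with
  | nil X => simp
  | cons e l X Y Z h t ih =>
    obtain ⟨a, b, c, d, i, _, R, S, K, hi⟩ := h
    simp only [Multiset.card_cons, Finset.card_insert_of_notMem hi.1, List.length_cons] at ih ⊢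
    omega

lemma BubbleMove.count {e : Colour} {X Y : Expr} (h : BubbleMove e X Y) :
    X.net.card = Y.net.card + 2 ∧ Y.sums = X.sums := by
  obtain ⟨⟩ := h
  simp

lemma Successively.bubbleMove_count {l : List Colour} {X Y : Expr}
    (h : Successively BubbleMove l X Y) :
    X.net.card = Y.net.card + 2 * l.length ∧ Y.sums = X.sums := by
  induction h with
  | nil X => simp
  | cons e l X Y Z h t ih =>
    refine ⟨?_, ih.2.trans h.count.2⟩
    rw [h.count.1, ih.1, List.length_cons]
    ring

/-- Every application of the Schur lemma removes two vertices and one summation. -/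
lemma burst_count {X Y : Expr} (h : Relation.ReflTransGen Burst X Y) :
    X.net.card + 2 * Y.sums.card = Y.net.card + 2 * X.sums.card := by
  induction h with
  | refl => rfl
  | tail _ h ih =>
    obtain ⟨p, q, x, y, R, S, K, hpq, hq⟩ := h
    have := Finset.card_erase_add_one hq
    simp only [Multiset.card_cons, Net.map, Multiset.card_map] at ih ⊢
    omega

/-- The numbers of vertices of `H_n` and `H_(n-1)` determine the number of bubbles in a passage, and
hence the number of new summations. -/
lemma Pass.count {m : ℕ} {col col' : Edge → Colour} {X Y : Expr}
    (h : Pass (m + 3) col col' X Y) (hX : X.net.card = (honeycomb (m + 3)).card) :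
    Y.net.card = (honeycomb (m + 2)).card ∧ Y.sums.card = X.sums.card + (2 * m + 1) := by
  obtain ⟨X₁, X₂, X₃, h₁, h₂, h₃, -, h₄, hY, -⟩ := h
  have hYc : Y.net.card = (honeycomb (m + 2)).card := by
    rw [hY]
    exact Multiset.card_map _ _
  refine ⟨hYc, ?_⟩
  obtain ⟨c₁, s₁⟩ := h₁.count
  obtain ⟨c₂, s₂⟩ := h₂.recouple_count
  have c₃ := burst_count h₃
  obtain ⟨c₄, s₄⟩ := h₄.bubbleMove_count
  rw [card_honeycomb] at hX hYc
  have e3 : (m + 2 + 1) ^ 2 - 1 = m * m + 6 * m + 8 := by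
    rw [Nat.sub_eq_iff_eq_add (Nat.one_le_pow _ _ (by omega))]
    ring
  have e2 : (m + 1 + 1) ^ 2 - 1 = m * m + 4 * m + 3 := by
    rw [Nat.sub_eq_iff_eq_add (Nat.one_le_pow _ _ (by omega))]
    ring
  rw [e3] at hX
  rw [e2] at hYc
  simp only [crownEdges, bubbleEdges, List.map_append, List.length_append, List.length_map,
    List.length_range, List.length_cons, List.length_nil] at s₂ c₄
  rw [s₁] at s₂
  rw [← s₄] at c₃
  omega

lemma Run.count {n : ℕ} {col : Edge → Colour} {X Z : Expr} (h : Run n col X Z)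
    (hX : X.net.card = (honeycomb n).card) :
    Z.sums.card = X.sums.card + (n - 2) ^ 2 := by
  induction h with
  | last col X Y Z h ht =>
    rw [← h.count.2]
    obtain ⟨⟩ := ht
    rfl
  | loop n hn col col' X Y Z h t ih =>
    obtain ⟨m, rfl⟩ := Nat.exists_eq_add_of_le' hn
    obtain ⟨hY, hS⟩ := h.count hX
    rw [ih hY, hS]
    simp only [Nat.add_sub_cancel, Nat.reduceSubDiff]
    ring

lemma Evaluates.card_eq {n : ℕ} {S : Finset Colour} {K : Multiset Coeff}
    (h : Evaluates n S K) : S.card = (n - 2) ^ 2 := by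
  have := Run.count h (Multiset.card_map _ _)
  simpa using this

end HoneycombNet

theorem mainTheorem4 :
    ∃ a : ℕ → ℕ,
      (∀ n : ℕ, 2 ≤ n →
        (∃ (S : Finset HoneycombNet.Colour) (K : Multiset HoneycombNet.Coeff),
          HoneycombNet.Evaluates n S K) ∧
        ∀ (S : Finset HoneycombNet.Colour) (K : Multiset HoneycombNet.Coeff),
          HoneycombNet.Evaluates n S K → S.card = a n) ∧
      (∀ n : ℕ, 3 ≤ n → (a n : ℤ) = (a (n - 1) : ℤ) + 2 * (n : ℤ) - 5) ∧
      (fun n : ℕ => (a n : ℝ)) =Θ[Filter.atTop] (fun n : ℕ => (n : ℝ) ^ 2) := by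
  refine ⟨fun n => (n - 2) ^ 2,
    fun n hn => ⟨HoneycombNet.exists_evaluates hn, fun S K h => h.card_eq⟩, ?_, ?_, ?_⟩
  · intro n hn
    obtain ⟨m, rfl⟩ := Nat.exists_eq_add_of_le' hn
    simp only [Nat.add_sub_cancel, Nat.reduceSubDiff]
    push_cast
    ring
  · refine Asymptotics.IsBigO.of_bound 1 (Filter.Eventually.of_forall fun n => ?_)
    rw [Real.norm_of_nonneg (by positivity), Real.norm_of_nonneg (by positivity), one_mul]
    exact_mod_cast Nat.pow_le_pow_left (Nat.sub_le n 2) 2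
  · refine Asymptotics.IsBigO.of_bound 9 ((Filter.eventually_ge_atTop 3).mono fun n hn => ?_)
    rw [Real.norm_of_nonneg (by positivity), Real.norm_of_nonneg (by positivity)]
    -- `n ≤ 3 (n - 2)` for `n ≥ 3`
    have h : n ^ 2 ≤ (3 * (n - 2)) ^ 2 := Nat.pow_le_pow_left (by omega) 2
    rw [mul_pow] at h
    exact_mod_cast h
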